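/- Let $\Lambda$ be a finite or countably infinite set and let $A=(A_{x,y})_{x,y\in\Lambda}$ be a conservative generator: $A_{x,y}\ge 0$ for $x\ne y$ and $\sum_{y}A_{x,y}=0$ for every $x$, with all entries finite. Let $(X_t)_{t\ge 0}$ be a right-continuous continuous-time Markov chain on $\Lambda$ (with the discrete topology) with generator $A$, that is, its transition probabilities $p_t(x,y)$ form a semigroup of stochastic matrices with $\lim_{t\downarrow 0}(p_t(x,y)-\delta_{x,y})/t=A_{x,y}$ for all $x,y$. Under $\mathbb P_a$ the chain starts at $X_0=a$. For $T>0$ and $x\in\Lambda$ let $\ell_T(x)=\int_0^T \mathbf 1_{\{X_s=x\}}\,ds$ be the local times and $R_T=\{X_s: s\in[0,T]\}$ the range. For a finite set $R\subseteq\Lambda$ put $\mathcal M_T^+(R)=\{l\colon R\to(0,\infty) : \sum_{x\in R} l(x)=T\}$, and let $\sigma_T$ be the Lebesgue measure on $\mathcal M_T^+(R)$ for which Lebesgue measure on $(0,\infty)^R$ disintegrates as $d^Rl=\int_0^\infty dT\,\sigma_T(dl)$; explicitly, for any $c\in R$, $\sigma_T$ is Lebesgue measure in the coordinates $(l_x)_{x\in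 R\setminus\{c\}}$ (a unit point mass if $|R|=1$). For $a,b\in R$ and a matrix $M$ let $\det^{(R)}_{ab}(M)$ be the determinant of the matrix $(\mathbf 1_{x\neq b}M_{x,y}\mathbf 1_{y\neq a}+\mathbf 1_{x=b,\,y=a})_{x,y\in R}$, and let $\partial_l$ be the diagonal matrix with entries $\partial_{l_x}$, so that $\det^{(R)}_{ab}(-A+\partial_l)$ is a linear differential operator with constant coefficients. **Theorem (density of the local times).** Let $R\subseteq\Lambda$ be finite and $a,b\in R$. For $l\in(0,\infty)^R$ let $$\rho^{(R)}_{ab}(l)=\det\nolimits^{(R)}_{ab}(-A+\partial_l)\int_{[0,2\pi]^R}\exp\Big(\sum_{x,y\in R}A_{x,y}\sqrt{l_x}\sqrt{l_y}\,e^{i(\theta_x-\theta_y)}\Big)\prod_{x\in R}\frac{d\theta_x}{2\pi}.$$ Then, for every $T>0$, $\rho^{(R)}_{ab}$ is integrable with respect to $\sigma_T$, and for every bounded measurable $F\colon\mathcal M_T^+(R)\to\mathbb R$, $$\mathbb E_a\big[F\big((\ell_T(x))_{x\in R}\big)\mathbf 1_{\{X_T=b\}}\mathbf 1_{\{R_T=R\}}\big]=\int_{\mathcal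 M_T^+(R)}F(l)\,\rho^{(R)}_{ab}(l)\,\sigma_T(dl).$$ (On $\{X_T=b,\,R_T=R\}$ the vector $(\ell_T(x))_{x\in R}$ lies in $\mathcal M_T^+(R)$ almost surely.) -/

import Mathlib

open MeasureTheory Filter Topology
open scoped NNReal ENNReal

noncomputable section

namespace LocalTimes

section Chain

variable {Λ : Type*} [DecidableEq Λ]

/-- A conservative generator (Q-matrix): nonnegative off-diagonal entries and zero row sums. -/
structure IsConservativeGenerator (A : Matrix Λ Λ ℝ) : Prop where
  offDiag_nonneg : ∀ x y, x ≠ y → 0 ≤ A x y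
  row_sum : ∀ x, HasSum (fun y => A x y) 0

/-- A (time-homogeneous, honest) transition function on `Λ`: a semigroup of stochastic matrices. -/
structure IsTransitionFunction (p : ℝ≥0 → Matrix Λ Λ ℝ) : Prop where
  nonneg : ∀ t x y, 0 ≤ p t x y
  row_sum : ∀ t x, HasSum (fun y => p t x y) 1
  zero : p 0 = 1
  chapman_kolmogorov : ∀ s t x y, HasSum (fun z => p s x z * p t z y) (p (s + t) x y)

/-- `A` is the entrywise right derivative at time `0` of the transition function `p`. -/
def HasGenerator (p : ℝ≥0 → Matrix Λ Λ ℝ) (A : Matrix Λ Λ ℝ) : Prop :=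
  ∀ x y, Tendsto (fun t : ℝ≥0 => (p t x y - (1 : Matrix Λ Λ ℝ) x y) / (t : ℝ))
    (𝓝[>] 0) (𝓝 (A x y))

/-- `X` is, under the law `P`, a continuous-time Markov chain on the discrete set `Λ` with
generator `A`, started at `a`: its finite-dimensional distributions are those of a transition
function with generator `A`, and almost every path is right-continuous for the discrete
topology. -/
structure IsMarkovChain {Ω : Type*} [MeasurableSpace Ω] (P : Measure Ω)
    (A : Matrix Λ Λ ℝ) (a : Λ) (X : ℝ≥0 → Ω → Λ) : Prop where
  measurable : ∀ t x, MeasurableSet {ω | X t ω = x}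
  right_continuous : ∀ᵐ ω ∂P, ∀ t, ∀ᶠ s in 𝓝[≥] t, X s ω = X t ω
  markov : ∃ p : ℝ≥0 → Matrix Λ Λ ℝ, IsTransitionFunction p ∧ HasGenerator p A ∧
    ∀ (n : ℕ) (t : ℕ → ℝ≥0) (x : ℕ → Λ), Monotone t → t 0 = 0 → x 0 = a →
      P.real {ω | ∀ i ≤ n, X (t i) ω = x i} =
        ∏ i ∈ Finset.range n, p (t (i + 1) - t i) (x i) (x (i + 1))

/-- The local time `ℓ_T(x) = ∫_0^T 1{X_s = x} ds`. -/
def localTime {Ω : Type*} (X : ℝ≥0 → Ω → Λ) (T : ℝ≥0) (x : Λ) (ω : Ω) : ℝ :=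
  ∫ s in (0 : ℝ)..T, if X s.toNNReal ω = x then 1 else 0

/-- The range `{X_s : s ∈ [0, T]}`. -/
def chainRange {Ω : Type*} (X : ℝ≥0 → Ω → Λ) (T : ℝ≥0) (ω : Ω) : Set Λ :=
  (fun s => X s ω) '' Set.Icc 0 T

end Chain

section Density

variable {ι : Type*} [Fintype ι] [DecidableEq ι]

/-- The open simplex `{l : ι → (0, ∞) | ∑ l = T}`. -/
def openSimplex (ι : Type*) [Fintype ι] (T : ℝ) : Set (ι → ℝ) :=
  {l | (∀ x, 0 < l x) ∧ ∑ x, l x = T}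

/-- The point of the hyperplane `∑ l = T` whose coordinates other than `c` are given by `u`. -/
def hyperplanePoint (c : ι) (T : ℝ) (u : {x : ι // x ≠ c} → ℝ) : ι → ℝ :=
  fun x => if h : x = c then T - ∑ y, u y else u ⟨x, h⟩

/-- The Lebesgue measure `σ_T` on the open simplex: Lebesgue measure in the coordinates other
than `c`, carried to the simplex. It disintegrates Lebesgue measure on the positive orthant along
`l ↦ ∑ l`, see `lintegral_simplexMeasure`. -/
def simplexMeasure (c : ι) (T : ℝ) : Measure (ι → ℝ) :=
  ((volume : Measure ({x : ι // x ≠ c} → ℝ)).map (hyperplanePoint c T)).restrict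
    (openSimplex ι T)

theorem measurable_hyperplanePoint (c : ι) (T : ℝ) : Measurable (hyperplanePoint c T) := by
  refine measurable_pi_lambda _ fun x => ?_
  by_cases h : x = c
  · simp only [hyperplanePoint, h, dite_true]
    fun_prop
  · simp only [hyperplanePoint, h, dite_false]
    fun_prop

theorem sum_hyperplanePoint (c : ι) (T : ℝ) (u : {x : ι // x ≠ c} → ℝ) :
    ∑ x, hyperplanePoint c T u x = T := by
  rw [Fintype.sum_eq_add_sum_subtype_ne _ c]
  have h : ∀ y : {x : ι // x ≠ c}, hyperplanePoint c T u y = u y := fun y => by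
    simp [hyperplanePoint, y.2]
  simp only [h]
  simp [hyperplanePoint]

/-- The measures `σ_T` disintegrate Lebesgue measure on `(0, ∞)^ι`:
`∫ F(l) dl = ∫_0^∞ dT ∫ F(l) σ_T(dl)`. -/
theorem lintegral_simplexMeasure (c : ι) (F : (ι → ℝ) → ℝ≥0∞) (hF : Measurable F) :
    ∫⁻ l in {l : ι → ℝ | ∀ x, 0 < l x}, F l =
      ∫⁻ T in Set.Ioi (0 : ℝ), ∫⁻ l, F l ∂(simplexMeasure c T) := by
  have hO : MeasurableSet {l : ι → ℝ | ∀ x, 0 < l x} := by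
    simp only [Set.ofPred_forall]
    exact MeasurableSet.iInter fun x => measurableSet_lt measurable_const (measurable_pi_apply x)
  have hS : ∀ T, MeasurableSet (openSimplex ι T) := fun T =>
    hO.inter (measurableSet_eq_fun (by fun_prop) measurable_const)
  set G : (ι → ℝ) → ℝ≥0∞ := Set.indicator {l : ι → ℝ | ∀ x, 0 < l x} F with hG
  have hGm : Measurable G := hF.indicator hO
  have key : ∀ T, ∫⁻ l, F l ∂(simplexMeasure c T) =
      ∫⁻ u : {x : ι // x ≠ c} → ℝ, G (hyperplanePoint c T u) := by
    intro T
    rw [simplexMeasure, ← lintegral_indicator (hS T),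
      lintegral_map (hF.indicator (hS T)) (measurable_hyperplanePoint c T)]
    refine lintegral_congr fun u => ?_
    by_cases h : ∀ x, 0 < hyperplanePoint c T u x
    · rw [hG, Set.indicator_of_mem (s := {l : ι → ℝ | ∀ x, 0 < l x}) h,
        Set.indicator_of_mem (s := openSimplex ι T) ⟨h, sum_hyperplanePoint c T u⟩]
    · rw [hG, Set.indicator_of_notMem (s := {l : ι → ℝ | ∀ x, 0 < l x}) h,
        Set.indicator_of_notMem (s := openSimplex ι T) fun h' => h h'.1]
  have hzero : ∀ T ≤ 0, ∀ u : {x : ι // x ≠ c} → ℝ, G (hyperplanePoint c T u) = 0 := by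
    intro T hT u
    rw [hG, Set.indicator_of_notMem]
    intro h
    have h1 : 0 < ∑ x, hyperplanePoint c T u x :=
      Finset.sum_pos (fun x _ => h x) ⟨c, Finset.mem_univ c⟩
    rw [sum_hyperplanePoint] at h1
    exact absurd h1 (not_lt.2 hT)
  let e₁ := MeasurableEquiv.piEquivPiSubtypeProd (fun _ : ι => ℝ) (fun x => x = c)
  have he₁ : MeasurePreserving e₁ := by
    convert volume_preserving_piEquivPiSubtypeProd (fun _ : ι => ℝ) (fun x => x = c)
  let e₂ : ({x : ι // x = c} → ℝ) ≃ᵐ ℝ := MeasurableEquiv.funUnique _ _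
  have he₂ : MeasurePreserving e₂ := volume_preserving_funUnique _ _
  let K : ℝ × ({x : ι // x ≠ c} → ℝ) → (ι → ℝ) :=
    fun q x => if h : x = c then q.1 else q.2 ⟨x, h⟩
  have hK : Measurable K := by
    refine measurable_pi_lambda _ fun x => ?_
    by_cases h : x = c
    · simp only [K, h, dite_true]
      fun_prop
    · simp only [K, h, dite_false]
      fun_prop
  have hmp : MeasurePreserving
      (fun l : ι → ℝ => ((l c, fun x => l x) : ℝ × ({x : ι // x ≠ c} → ℝ))) :=
    (he₂.prod (MeasurePreserving.id (volume : Measure ({x : ι // x ≠ c} → ℝ)))).comp he₁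
  have hKl : ∀ l : ι → ℝ, K (l c, fun x => l x) = l := by
    intro l
    funext x
    by_cases h : x = c
    · subst h; simp [K]
    · simp [K, h]
  calc ∫⁻ l in {l : ι → ℝ | ∀ x, 0 < l x}, F l
      = ∫⁻ l, G l := (lintegral_indicator hO F).symm
    _ = ∫⁻ l : ι → ℝ, G (K (l c, fun x => l x)) := by simp only [hKl]
    _ = ∫⁻ q : ℝ × ({x : ι // x ≠ c} → ℝ), G (K q) :=
        hmp.lintegral_comp (hGm.comp hK)
    _ = ∫⁻ u : {x : ι // x ≠ c} → ℝ, ∫⁻ s : ℝ, G (K (s, u)) := by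
        rw [Measure.volume_eq_prod]
        exact lintegral_prod_symm' _ (hGm.comp hK)
    _ = ∫⁻ u : {x : ι // x ≠ c} → ℝ, ∫⁻ T : ℝ, G (K (T - ∑ y, u y, u)) := by
        refine lintegral_congr fun u => ?_
        exact (lintegral_sub_right_eq_self (fun s => G (K (s, u))) _).symm
    _ = ∫⁻ T : ℝ, ∫⁻ u : {x : ι // x ≠ c} → ℝ, G (K (T - ∑ y, u y, u)) := by
        refine lintegral_lintegral_swap (Measurable.aemeasurable ?_)
        exact (hGm.comp hK).comp
          (g := G ∘ K) (f := fun q : ({x : ι // x ≠ c} → ℝ) × ℝ => (q.2 - ∑ y, q.1 y, q.1))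
          (by fun_prop)
    _ = ∫⁻ T : ℝ, ∫⁻ u : {x : ι // x ≠ c} → ℝ, G (hyperplanePoint c T u) := rfl
    _ = ∫⁻ T in Set.Ioi (0 : ℝ), ∫⁻ l, F l ∂(simplexMeasure c T) := by
        rw [← lintegral_indicator measurableSet_Ioi]
        refine lintegral_congr fun T => ?_
        by_cases hT : 0 < T
        · rw [Set.indicator_of_mem (Set.mem_Ioi.2 hT), key]
        · rw [Set.indicator_of_notMem (by simpa using hT)]
          simp [hzero T (not_lt.1 hT)]

/-- The cofactor `det_ab(M)`: the determinant of
`(1_{x ≠ b} M_{x,y} 1_{y ≠ a} + 1_{x = b, y = a})_{x,y}`. -/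
def cofactor {S : Type*} [CommRing S] (a b : ι) (M : Matrix ι ι S) : S :=
  Matrix.det (Matrix.of fun x y =>
    (if x ≠ b ∧ y ≠ a then M x y else 0) + (if x = b ∧ y = a then 1 else 0))

/-- The partial derivative `∂_{l_x}`. -/
def partialDeriv (x : ι) (f : (ι → ℝ) → ℂ) : (ι → ℝ) → ℂ :=
  fun l => lineDeriv ℝ f l (Pi.single x 1)

/-- The mixed partial derivative `∏_x ∂_{l_x} ^ (m x)`, the factors being composed in an arbitrary
order, which is irrelevant where `f` is smooth. -/
def mixedPartial (m : ι →₀ ℕ) (f : (ι → ℝ) → ℂ) : (ι → ℝ) → ℂ :=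
  (Finsupp.toMultiset m).toList.foldr partialDeriv f

/-- The constant-coefficient differential operator `q(∂_l)` obtained by substituting `∂_{l_x}`
for the variable `X x` of the polynomial `q`. -/
def diffOp (q : MvPolynomial ι ℝ) (f : (ι → ℝ) → ℂ) : (ι → ℝ) → ℂ :=
  fun l => ∑ m ∈ q.support, ((q.coeff m : ℝ) : ℂ) * mixedPartial m f l

/-- The matrix `M + diag(X_x)` over the polynomial ring; substituting `∂_{l_x}` for `X_x` turns it
into the matrix `M + ∂_l` of differential operators. -/
def symbolMatrix (M : Matrix ι ι ℝ) : Matrix ι ι (MvPolynomial ι ℝ) :=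
  M.map MvPolynomial.C + Matrix.diagonal MvPolynomial.X

/-- `∫_{[0,2π]^ι} exp(∑_{x,y} A_{x,y} √l_x √l_y e^{i(θ_x - θ_y)}) ∏_x dθ_x / (2π)`. -/
def angularIntegral (A : Matrix ι ι ℝ) (l : ι → ℝ) : ℂ :=
  (∫ θ in Set.univ.pi fun _ : ι => Set.Icc (0 : ℝ) (2 * Real.pi),
    Complex.exp (∑ x, ∑ y, (A x y : ℂ) * (√(l x) : ℂ) * (√(l y) : ℂ) *
      Complex.exp (Complex.I * ((θ x : ℂ) - (θ y : ℂ))))) /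
    (2 * (Real.pi : ℂ)) ^ Fintype.card ι

/-- `det_ab(-A + ∂_l)` applied to the angular integral. -/
def density (A : Matrix ι ι ℝ) (a b : ι) : (ι → ℝ) → ℂ :=
  diffOp (cofactor a b (symbolMatrix (-A))) (angularIntegral A)

end Density

end LocalTimes

end

/-! Both sides are compared through characteristic functions in the local times, and both
characteristic functions are power series in `T` whose coefficients count words with a prescribed
set of letters.

Density side. Put `w_x = e^{iθ_x}` and `D_y = (∑_x w_x B_{xy}) / w_y`. With `B = A`, rescaling `w_x`
by `√l_x` turns `∑_y l_y D_y` into the exponent of the angular integral. Since the torus average is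
unchanged when the radii are moved (contour shift), the angular integral is the average of `exp(∑
l_y D_y)`. Each `∂_{l_y}` then multiplies the integrand by `D_y`, so the density is the average of
`adj(diag D - B)_{ab} exp(∑ l_y D_y)`. Expanding the exponential and applying the Dirichlet integral
on the simplex gives total mass `∑_N T^N / N! · c_N`, where `c_N` averages `adj(diag D - B)_{ab}`
times a complete homogeneous polynomial in `D` (`integrable_and_hasSum_integral_entireDensity`).

Combinatorial core. `c_N` is the total `B`-weight of words of `N + 1` letters from `a` to `b` using
every letter (`coveringWeight_succ`, `sum_powerset_coveringWeight`). One strips the last letter `b`.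
Since `w` is a left null vector of `diag D - B`, its determinant vanishes and `adj · (diag D - B) =
0`, which handles words that still cover everything without their last letter. Otherwise the
integrand is entire in `w_b`, and the mean value property sets `w_b = 0`, which deletes `b`.

Chain side. On the event that the path stays in a finite set and ends in `b`, `exp(i ∑ v_y ℓ_T(y))`
is a limit of functionals of the path on a grid. Their expectations are powers of a matrix `1 +
(T/n)(A + i diag v) + o(1/n)` on that set, hence converge to `exp(T(A + i diag v))_{ab}`.
Inclusion-exclusion over subsets passes from range inside the set to range equal to it, and from all
words to covering words.

The two series agree for `B = A + i diag v`. Adding `i diag v` to `B` only multiplies the density by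
`exp(i ∑ l_y v_y)`, so this is equality of characteristic functions, and uniqueness extends it to
all bounded measurable `F`. -/

noncomputable section

namespace LocalTimes

/-! ### Torus averages: contour shifts and removal of a state -/

section Torus

/-- The uniform probability measure on the angles `[0, 2π]`. -/
def angleMeasure : Measure ℝ :=
  ENNReal.ofReal (2 * Real.pi)⁻¹ • volume.restrict (Set.Icc 0 (2 * Real.pi))

instance : IsProbabilityMeasure angleMeasure := by
  constructor
  have : (0 : ℝ) < 2 * Real.pi := by positivity
  simp only [angleMeasure, Measure.smul_apply, Measure.restrict_apply_univ, Real.volume_Icc,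
    smul_eq_mul, sub_zero]
  rw [← ENNReal.ofReal_mul (by positivity), inv_mul_cancel₀ this.ne', ENNReal.ofReal_one]

theorem integral_angleMeasure (f : ℝ → ℂ) :
    ∫ t, f t ∂angleMeasure = (2 * Real.pi)⁻¹ • ∫ t in (0 : ℝ)..2 * Real.pi, f t := by
  have h : (0 : ℝ) ≤ 2 * Real.pi := by positivity
  rw [angleMeasure, integral_smul_measure, intervalIntegral.integral_of_le h,
    ENNReal.toReal_ofReal (by positivity), integral_Icc_eq_integral_Ioc]

theorem integral_angleMeasure_comp_circleMap (f : ℂ → ℂ) (r : ℝ) :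
    ∫ t, f (r * Complex.exp (Complex.I * t)) ∂angleMeasure = Real.circleAverage f 0 r := by
  rw [integral_angleMeasure, Real.circleAverage_def]
  simp [circleMap, mul_comm]

/-- The mean value property of entire functions on the unit circle. -/
theorem integral_angleMeasure_of_differentiable {f : ℂ → ℂ} (hf : Differentiable ℂ f) :
    ∫ t : ℝ, f (Complex.exp (Complex.I * t)) ∂angleMeasure = f 0 := by
  have h := integral_angleMeasure_comp_circleMap f 1
  rw [DiffContOnCl.circleAverage hf.diffContOnCl] at h
  simpa using h

/-- Circle averages around the origin of a function holomorphic away from it do not depend on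
the radius. -/
theorem circleAverage_eq_of_differentiable_punctured {f : ℂ → ℂ}
    (hf : ∀ z ≠ 0, DifferentiableAt ℂ f z) {r s : ℝ} (hr : 0 < r) (hs : 0 < s) :
    Real.circleAverage f 0 r = Real.circleAverage f 0 s := by
  wlog h : r ≤ s generalizing r s
  · exact (this hs hr (le_of_not_ge h)).symm
  rw [Real.circleAverage_eq_circleIntegral hr.ne', Real.circleAverage_eq_circleIntegral hs.ne',
    Complex.circleIntegral_sub_center_inv_smul_eq_of_differentiable_on_annulus_off_countable hr h
      Set.countable_empty]
  · intro z hz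
    refine (hf z ?_).continuousAt.continuousWithinAt
    rintro rfl
    exact hz.2 (Metric.mem_ball_self hr)
  · intro z hz
    refine hf z ?_
    rintro rfl
    exact hz.1.2 (Metric.mem_closedBall_self hr.le)

section Phase

variable {ι : Type*}

/-- The unit complex number `e^{iθ_x}`. -/
def phase (θ : ι → ℝ) (x : ι) : ℂ := Complex.exp (Complex.I * θ x)

theorem phase_ne_zero (θ : ι → ℝ) (x : ι) : phase θ x ≠ 0 := Complex.exp_ne_zero _

theorem continuous_phase (x : ι) : Continuous fun θ : ι → ℝ => phase θ x := by
  unfold phase; fun_prop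

theorem phase_update_self [DecidableEq ι] (θ : ι → ℝ) (b : ι) (t : ℝ) :
    phase (Function.update θ b t) b = Complex.exp (Complex.I * t) := by
  simp [phase]

theorem phase_update_of_ne [DecidableEq ι] (θ : ι → ℝ) {b x : ι} (h : x ≠ b) (t : ℝ) :
    phase (Function.update θ b t) x = phase θ x := by
  simp [phase, h]

/-- The quotients `(∑_{x ∈ S} w_x B_{x,y}) / w_y`. -/
def ratio (B : Matrix ι ι ℂ) (S : Finset ι) (w : ι → ℂ) (y : ι) : ℂ :=
  ∑ x ∈ S, w x * B x y * (w y)⁻¹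

theorem continuous_ratio_phase (B : Matrix ι ι ℂ) (S : Finset ι) :
    Continuous fun θ : ι → ℝ => ratio B S (phase θ) := by
  refine continuous_pi fun y => ?_
  unfold ratio
  refine continuous_finsetSum _ fun x _ => ?_
  exact ((continuous_phase x).mul continuous_const).mul
    ((continuous_phase y).inv₀ fun θ => phase_ne_zero θ y)

end Phase

variable {ι : Type*} [Fintype ι]

/-- The uniform probability measure on the angles `[0, 2π]^ι`. -/
def torusMeasure (ι : Type*) [Fintype ι] : Measure (ι → ℝ) :=
  Measure.pi fun _ => angleMeasure

instance : IsProbabilityMeasure (torusMeasure ι) := by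
  unfold torusMeasure; infer_instance

theorem torusMeasure_eq_smul :
    torusMeasure ι = ENNReal.ofReal (2 * Real.pi)⁻¹ ^ Fintype.card ι •
      volume.restrict (Set.univ.pi fun _ : ι => Set.Icc (0 : ℝ) (2 * Real.pi)) := by
  refine Measure.pi_eq fun s hs => ?_
  simp only [Measure.smul_apply, smul_eq_mul, angleMeasure]
  rw [volume_pi, Measure.restrict_pi_pi, Measure.pi_pi, Finset.prod_mul_distrib]
  simp

theorem integral_torusMeasure (f : (ι → ℝ) → ℂ) :
    ∫ θ, f θ ∂torusMeasure ι =
      (∫ θ in Set.univ.pi fun _ : ι => Set.Icc (0 : ℝ) (2 * Real.pi), f θ) /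
        (2 * (Real.pi : ℂ)) ^ Fintype.card ι := by
  rw [torusMeasure_eq_smul, integral_smul_measure, ENNReal.toReal_pow,
    ENNReal.toReal_ofReal (by positivity), Complex.real_smul, div_eq_inv_mul]
  push_cast
  rw [inv_pow]

theorem integrable_torusMeasure {E : Type*} [NormedAddCommGroup E] {f : (ι → ℝ) → E}
    (hf : Continuous f) : Integrable f (torusMeasure ι) := by
  rw [torusMeasure_eq_smul]
  refine Integrable.smul_measure ?_ (by simp)
  exact hf.continuousOn.integrableOn_compact (isCompact_univ_pi fun _ => isCompact_Icc)

/-- Resampling one angle preserves the uniform measure. -/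
theorem measurePreserving_update_torusMeasure [DecidableEq ι] (b : ι) :
    MeasurePreserving (fun q : (ι → ℝ) × ℝ => Function.update q.1 b q.2)
      ((torusMeasure ι).prod angleMeasure) (torusMeasure ι) := by
  have hm : Measurable (fun q : (ι → ℝ) × ℝ => Function.update q.1 b q.2) := by
    refine measurable_pi_lambda _ fun x => ?_
    by_cases h : x = b
    · subst h; simpa using measurable_snd
    · simp only [Function.update_of_ne h]
      fun_prop
  refine ⟨hm, ?_⟩
  refine (Measure.pi_eq fun s hs => ?_).symm
  rw [Measure.map_apply hm (MeasurableSet.univ_pi hs)]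
  have : (fun q : (ι → ℝ) × ℝ => Function.update q.1 b q.2) ⁻¹' Set.univ.pi s =
      (Set.univ.pi (Function.update s b Set.univ)) ×ˢ s b := by
    ext ⟨θ, t⟩
    simp only [Set.mem_preimage, Set.mem_univ_pi, Set.mem_prod]
    constructor
    · intro h
      refine ⟨fun x => ?_, by simpa using h b⟩
      by_cases hx : x = b
      · subst hx; simp
      · simpa [hx] using h x
    · rintro ⟨h, hb⟩ x
      by_cases hx : x = b
      · subst hx; simpa using hb
      · simpa [hx] using h x
  rw [this, Measure.prod_prod, torusMeasure, Measure.pi_pi,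
    ← Finset.mul_prod_erase _ (fun x => angleMeasure (s x)) (Finset.mem_univ b),
    ← Finset.mul_prod_erase _ (fun x => angleMeasure (Function.update s b Set.univ x))
      (Finset.mem_univ b)]
  simp only [Function.update_self, measure_univ, one_mul]
  rw [mul_comm]
  congr 1
  refine Finset.prod_congr rfl fun x hx => ?_
  rw [Function.update_of_ne (Finset.ne_of_mem_erase hx)]

theorem integral_torusMeasure_update [DecidableEq ι] (b : ι) {f : (ι → ℝ) → ℂ}
    (hf : Continuous f) :
    ∫ θ, f θ ∂torusMeasure ι =
      ∫ θ, ∫ t, f (Function.update θ b t) ∂angleMeasure ∂torusMeasure ι := by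
  have h := measurePreserving_update_torusMeasure b
  rw [← h.map_eq, integral_map h.measurable.aemeasurable
    (hf.aestronglyMeasurable), integral_prod, h.map_eq]
  exact (h.integrable_comp hf.aestronglyMeasurable).2 (integrable_torusMeasure hf)

theorem integrable_comp_ratio_phase (B : Matrix ι ι ℂ) (S : Finset ι)
    {Q : (ι → ℂ) → ℂ} (hQ : Differentiable ℂ Q) :
    Integrable (fun θ => Q (ratio B S (phase θ))) (torusMeasure ι) :=
  integrable_torusMeasure (hQ.continuous.comp (continuous_ratio_phase B S))

variable [DecidableEq ι]

/-- Contour shift: the torus average of a function of the ratios does not depend on the radii. -/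
theorem integral_ratio_smul_phase (B : Matrix ι ι ℂ) {Q : (ι → ℂ) → ℂ} (hQ : Differentiable ℂ Q)
    (r : ι → ℝ) (hr : ∀ x, 0 < r x) :
    ∫ θ, Q (ratio B Finset.univ fun x => r x * phase θ x) ∂torusMeasure ι =
      ∫ θ, Q (ratio B Finset.univ (phase θ)) ∂torusMeasure ι := by
  have hcont : ∀ r : ι → ℝ, (∀ x, 0 < r x) →
      Continuous fun θ => Q (ratio B Finset.univ fun x => r x * phase θ x) := by
    intro r hr
    refine hQ.continuous.comp (continuous_pi fun y => ?_)
    unfold ratio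
    refine continuous_finsetSum _ fun x _ => ?_
    have := fun x => continuous_phase (ι := ι) x
    refine Continuous.mul (by fun_prop) (Continuous.inv₀ (by fun_prop) fun θ => ?_)
    exact mul_ne_zero (by exact_mod_cast (hr y).ne') (phase_ne_zero θ y)
  -- The radii are moved from 1 to `r` one coordinate at a time.
  suffices h : ∀ S : Finset ι,
      ∫ θ, Q (ratio B Finset.univ fun x => (if x ∈ S then r x else 1 : ℝ) * phase θ x)
        ∂torusMeasure ι = ∫ θ, Q (ratio B Finset.univ (phase θ)) ∂torusMeasure ι by
    simpa using h Finset.univ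
  intro S
  induction S using Finset.induction_on with
  | empty => simp
  | insert b S hb ih =>
    rw [← ih]
    have hpos : ∀ (S : Finset ι) x, 0 < (if x ∈ S then r x else 1 : ℝ) := by
      intro S x; split_ifs; exacts [hr x, one_pos]
    rw [integral_torusMeasure_update b (hcont _ (hpos _)),
      integral_torusMeasure_update b (hcont _ (hpos _))]
    refine integral_congr_ae (ae_of_all _ fun θ => ?_)
    -- With the other coordinates frozen, `w_b` enters the ratios only as `z` and `1/z`, so the only
    -- possible singularity is at 0.
    let g : ℂ → ℂ := fun z => Q (ratio B Finset.univ
      fun x => if x = b then z else (if x ∈ S then r x else 1 : ℝ) * phase θ x)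
    have hg : ∀ z ≠ 0, DifferentiableAt ℂ g z := by
      intro z hz
      refine (hQ _).comp z (differentiableAt_pi.2 fun y => ?_)
      unfold ratio
      refine DifferentiableAt.fun_sum fun x _ => ?_
      have hd : ∀ x, DifferentiableAt ℂ (fun z : ℂ => if x = b then z else
          (if x ∈ S then r x else 1 : ℝ) * phase θ x) z := by
        intro x
        by_cases h : x = b <;> simp [h]
      refine ((hd x).mul_const _).mul ((hd y).inv ?_)
      split_ifs
      · exact hz
      · exact mul_ne_zero (by exact_mod_cast (hr y).ne') (phase_ne_zero θ y)
      · simpa using phase_ne_zero θ y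
    have key : ∀ (r' : ι → ℝ), (∀ x ≠ b, r' x = if x ∈ S then r x else 1) → ∀ t : ℝ,
        Q (ratio B Finset.univ fun x => r' x * phase (Function.update θ b t) x) =
          g (r' b * Complex.exp (Complex.I * t)) := by
      intro r' h t
      refine congrArg (fun w => Q (ratio B Finset.univ w)) (funext fun x => ?_)
      by_cases hx : x = b
      · subst hx; simp [phase_update_self]
      · simp only [hx, if_false, phase_update_of_ne θ hx, h x hx]
    beta_reduce
    simp_rw [key (fun x => if x ∈ insert b S then r x else 1)
      (fun x hx => by simp [hx]), key (fun x => if x ∈ S then r x else 1) (fun x _ => rfl)]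
    rw [integral_angleMeasure_comp_circleMap, integral_angleMeasure_comp_circleMap]
    exact circleAverage_eq_of_differentiable_punctured hg (hpos _ _) (hpos _ _)

/-- Averaging over the phase at `b` removes the state `b`. -/
theorem integral_ratio_erase (B : Matrix ι ι ℂ) (S : Finset ι) (b : ι) (hb : b ∈ S)
    {Q : (ι → ℂ) → ℂ} (hQ : Differentiable ℂ Q)
    (hQb : ∀ D D' : ι → ℂ, (∀ x ≠ b, D x = D' x) → Q D = Q D') :
    ∫ θ, Q (ratio B S (phase θ)) ∂torusMeasure ι =
      ∫ θ, Q (ratio B (S.erase b) (phase θ)) ∂torusMeasure ι := by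
  have hc : Continuous fun θ => Q (ratio B S (phase θ)) :=
    hQ.continuous.comp (continuous_ratio_phase B S)
  rw [integral_torusMeasure_update b hc]
  refine integral_congr_ae (ae_of_all _ fun θ => ?_)
  -- For `y ≠ b` the variable `w_b` enters `D_y` linearly, with no inverse, so `g` is entire. The
  -- coordinate `y = b` of the argument is not the true ratio, but `Q` ignores it.
  let g : ℂ → ℂ := fun z => Q fun y =>
    z * (B b y * (phase θ y)⁻¹) + ratio B (S.erase b) (phase θ) y
  have hg : Differentiable ℂ g := by
    refine hQ.comp (differentiable_pi.2 fun y => ?_)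
    fun_prop
  have key : ∀ t : ℝ, Q (ratio B S (phase (Function.update θ b t))) =
      g (Complex.exp (Complex.I * t)) := by
    intro t
    refine hQb _ _ fun y hy => ?_
    unfold ratio
    rw [← Finset.add_sum_erase _ _ hb, phase_update_self, phase_update_of_ne θ hy, mul_assoc]
    congr 1
    refine Finset.sum_congr rfl fun x hx => ?_
    rw [phase_update_of_ne θ (Finset.ne_of_mem_erase hx)]
  beta_reduce
  simp_rw [key]
  rw [integral_angleMeasure_of_differentiable hg]
  simp [g]

end Torus

/-! ### Cofactors and the adjugate -/

section Cofactors

variable {ι : Type*} [DecidableEq ι] {K : Type*} [CommRing K]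

/-- The matrix `M` with row and column `b` replaced by those of the identity. -/
def isolate (M : Matrix ι ι K) (b : ι) : Matrix ι ι K :=
  (M.updateRow b (Pi.single b 1)).updateCol b (Pi.single b 1)

variable [Fintype ι]

/-- When row `b` is a unit vector supported at `a`, the rest of column `a` is invisible to the
determinant: the difference of the two columns gives a matrix with zero row `b`. -/
theorem det_updateCol_of_row_eq_single {M : Matrix ι ι K} {a b : ι} (h : M b = Pi.single a 1) :
    (M.updateCol a (Pi.single b 1)).det = M.det := by
  have hM : M = M.updateCol a (Pi.single b 1 + (M.col a - Pi.single b 1)) := by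
    rw [add_sub_cancel]
    exact (Matrix.updateCol_eq_self M a).symm
  conv_rhs => rw [hM, Matrix.det_updateCol_add]
  rw [left_eq_add]
  refine Matrix.det_eq_zero_of_row_eq_zero b fun y => ?_
  by_cases hy : y = a
  · subst hy; simp [h, Matrix.col]
  · simp [h, hy]

/-- `cofactor` clears both a row and a column while `adjugate` replaces only a row; the column is
free by the previous lemma. This makes adjugate identities available for the operator in the
statement. -/
theorem cofactor_eq_adjugate (a b : ι) (M : Matrix ι ι K) :
    cofactor a b M = M.adjugate a b := by
  rw [Matrix.adjugate_apply, cofactor,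
    ← det_updateCol_of_row_eq_single (a := a) (b := b)
      (M := M.updateRow b (Pi.single a 1)) (Matrix.updateRow_self)]
  congr 1
  ext x y
  by_cases hx : x = b <;> by_cases hy : y = a <;>
    simp [hx, hy, Matrix.updateRow_apply]

theorem adjugate_self_eq_det_isolate (M : Matrix ι ι K) (b : ι) :
    M.adjugate b b = (isolate M b).det := by
  rw [Matrix.adjugate_apply, isolate,
    det_updateCol_of_row_eq_single (Matrix.updateRow_self)]

/-- Replacing row `b` by the unit vector does not change the `(a,b)` entry of the adjugate. For the
new matrix `M'`, the off-diagonal entry `(a,b)` of `adj M' · M'` is zero, and `M' b b = 1` isolates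
the wanted term. The right side no longer involves the diagonal entry at `b`. -/
theorem adjugate_eq_sum_isolate (M : Matrix ι ι K) {a b : ι} (hab : a ≠ b) :
    M.adjugate a b = -∑ y ∈ Finset.univ.erase b, (isolate M b).adjugate a y * M y b := by
  set M' := M.updateRow b (Pi.single b 1) with hM'
  have h1 : M'.adjugate a b = M.adjugate a b := by
    rw [Matrix.adjugate_apply, Matrix.adjugate_apply, hM', Matrix.updateRow_idem]
  have h2 : ∀ y ≠ b, M'.adjugate a y = (isolate M b).adjugate a y := by
    intro y hy
    rw [Matrix.adjugate_apply, Matrix.adjugate_apply,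
      ← det_updateCol_of_row_eq_single (a := b) (b := b) (M := M'.updateRow y (Pi.single a 1))]
    · congr 1
      ext x z
      by_cases hz : z = b
      · subst hz
        by_cases hx : x = y
        · subst hx; simp [hy, hab.symm]
        · simp [isolate, hx]
      · by_cases hx : x = y <;> simp [isolate, hx, hz, hM', Matrix.updateRow_apply]
    · rw [Matrix.updateRow_ne hy.symm, hM', Matrix.updateRow_self]
  have h3 := congrFun (congrFun (Matrix.adjugate_mul M') a) b
  rw [Matrix.mul_apply, ← Finset.add_sum_erase _ _ (Finset.mem_univ b), h1] at h3
  have h4 : M' b b = 1 := by simp [hM']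
  rw [h4, mul_one, Matrix.smul_apply, Matrix.one_apply_ne hab, smul_zero] at h3
  rw [eq_neg_of_add_eq_zero_left h3]
  congr 1
  refine Finset.sum_congr rfl fun y hy => ?_
  have hy := Finset.ne_of_mem_erase hy
  rw [h2 y hy, hM', Matrix.updateRow_ne hy]

end Cofactors

/-! ### Complete homogeneous symmetric polynomials -/

section CompleteHomogeneous

variable {ι : Type*} [DecidableEq ι]

/-- The complete homogeneous symmetric polynomial of degree `n` in the variables `D x`, `x ∈ S`. -/
def completeHomogeneous (S : Finset ι) (n : ℕ) (D : ι → ℂ) : ℂ :=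
  ∑ k ∈ S.piAntidiag n, ∏ x ∈ S, D x ^ k x

theorem completeHomogeneous_zero (S : Finset ι) (D : ι → ℂ) : completeHomogeneous S 0 D = 1 := by
  simp [completeHomogeneous]

theorem completeHomogeneous_cons {S : Finset ι} {b : ι} (hb : b ∉ S) (n : ℕ) (D : ι → ℂ) :
    completeHomogeneous (S.cons b hb) n D =
      ∑ p ∈ Finset.HasAntidiagonal.antidiagonal n, D b ^ p.1 * completeHomogeneous S p.2 D := by
  unfold completeHomogeneous
  rw [Finset.piAntidiag_cons, Finset.sum_disjiUnion]
  refine Finset.sum_congr rfl fun p _ => ?_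
  rw [Finset.sum_map, Finset.mul_sum]
  refine Finset.sum_congr rfl fun k hk => ?_
  rw [Finset.prod_cons]
  have hkb : k b = 0 := by
    by_contra h
    exact hb ((Finset.mem_piAntidiag.1 hk).2 b h)
  congr 1
  · simp [hkb]
  · refine Finset.prod_congr rfl fun x hx => ?_
    have : x ≠ b := fun h => hb (h ▸ hx)
    simp [this]

/-- Monomials of degree `n + 1` either contain the variable at `b`, and one factor splits off, or do
not involve it. -/
theorem completeHomogeneous_succ {S : Finset ι} {b : ι} (hb : b ∈ S) (n : ℕ) (D : ι → ℂ) :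
    completeHomogeneous S (n + 1) D =
      D b * completeHomogeneous S n D + completeHomogeneous (S.erase b) (n + 1) D := by
  obtain ⟨S, hbS, rfl⟩ : ∃ S', ∃ h : b ∉ S', S = Finset.cons b S' h :=
    ⟨S.erase b, Finset.notMem_erase b S, by simp [Finset.insert_erase hb]⟩
  rw [completeHomogeneous_cons, completeHomogeneous_cons, Finset.Nat.antidiagonal_succ,
    Finset.sum_cons, Finset.sum_map, Finset.mul_sum]
  simp only [Finset.cons_eq_insert, Finset.erase_insert hbS]
  rw [add_comm]
  congr 1
  · refine Finset.sum_congr rfl fun p _ => ?_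
    simp [pow_succ]
    ring
  · simp

theorem completeHomogeneous_empty_succ (n : ℕ) (D : ι → ℂ) :
    completeHomogeneous ∅ (n + 1) D = 0 := by
  simp [completeHomogeneous]

theorem differentiable_completeHomogeneous [Fintype ι] (S : Finset ι) (n : ℕ) :
    Differentiable ℂ (completeHomogeneous S n) := by
  unfold completeHomogeneous
  fun_prop

/-- The complete homogeneous symmetric polynomial whose degree together with `S.card` is `N + 1`. -/
def holdingWeight (S : Finset ι) (N : ℕ) (D : ι → ℂ) : ℂ :=
  if S.card ≤ N + 1 then completeHomogeneous S (N + 1 - S.card) D else 0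

/-- This is the recursion of `completeHomogeneous_succ` with the degree shifted by the cardinality.
At the boundary `S.card = N + 2` the first term on the right is zero and both remaining polynomials
have degree 0. -/
theorem holdingWeight_succ {S : Finset ι} {b : ι} (hb : b ∈ S) (N : ℕ) (D : ι → ℂ) :
    holdingWeight S (N + 1) D = D b * holdingWeight S N D + holdingWeight (S.erase b) N D := by
  have hc := Finset.card_erase_add_one hb
  unfold holdingWeight
  rcases lt_trichotomy (S.card) (N + 2) with h | h | h
  · rw [if_pos (by omega), if_pos (by omega), if_pos (by omega),
      show N + 1 + 1 - S.card = N + 1 - S.card + 1 by omega, completeHomogeneous_succ hb,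
      show N + 1 - (S.erase b).card = N + 1 - S.card + 1 by omega]
  · rw [if_pos (by omega), if_neg (by omega), if_pos (by omega),
      show N + 1 + 1 - S.card = 0 by omega, show N + 1 - (S.erase b).card = 0 by omega]
    simp [completeHomogeneous_zero]
  · rw [if_neg (by omega), if_neg (by omega), if_neg (by omega)]
    simp

theorem holdingWeight_empty (N : ℕ) (D : ι → ℂ) : holdingWeight ∅ N D = 0 := by
  simp [holdingWeight, completeHomogeneous_empty_succ]

theorem holdingWeight_congr {S : Finset ι} (N : ℕ) {D D' : ι → ℂ} (h : ∀ x ∈ S, D x = D' x) :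
    holdingWeight S N D = holdingWeight S N D' := by
  unfold holdingWeight completeHomogeneous
  congr 1
  refine Finset.sum_congr rfl fun k _ => Finset.prod_congr rfl fun x hx => ?_
  rw [h x hx]

theorem differentiable_holdingWeight [Fintype ι] (S : Finset ι) (N : ℕ) :
    Differentiable ℂ (holdingWeight S N) := by
  unfold holdingWeight
  split_ifs
  · exact differentiable_completeHomogeneous _ _
  · exact differentiable_const _

end CompleteHomogeneous

/-! ### Weights of words with a prescribed set of letters -/

section Covering

variable {ι : Type*} [DecidableEq ι] (B : Matrix ι ι ℂ)

/-- The matrix `diag D - B` on `S`, extended by the identity. -/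
def maskedMatrix (S : Finset ι) (D : ι → ℂ) : Matrix ι ι ℂ :=
  Matrix.of fun x y => if x ∈ S ∧ y ∈ S then (Matrix.diagonal D - B) x y else (1 : Matrix ι ι ℂ) x y

theorem maskedMatrix_empty (D : ι → ℂ) : maskedMatrix B ∅ D = 1 := by
  ext x y; simp [maskedMatrix]

theorem maskedMatrix_congr {S : Finset ι} {D D' : ι → ℂ} (h : ∀ x ∈ S, D x = D' x) :
    maskedMatrix B S D = maskedMatrix B S D' := by
  ext x y
  simp only [maskedMatrix, Matrix.of_apply]
  split_ifs with hxy
  · rcases eq_or_ne x y with rfl | hne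
    · simp [h x hxy.1]
    · simp [hne]
  · rfl

theorem isolate_maskedMatrix (S : Finset ι) (D : ι → ℂ) (b : ι) :
    isolate (maskedMatrix B S D) b = maskedMatrix B (S.erase b) D := by
  ext x y
  by_cases hx : x = b <;> by_cases hy : y = b <;>
    simp [isolate, maskedMatrix, hx, hy, Matrix.updateRow_apply,
      Matrix.one_apply, Ne.symm, eq_comm]

variable [Fintype ι]

theorem maskedMatrix_univ (D : ι → ℂ) :
    maskedMatrix B Finset.univ D = Matrix.diagonal D - B := by
  ext x y; simp [maskedMatrix]

/-- The ratios are chosen so that `w`, restricted to `S`, is a left null vector of `diag D - B` on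
`S`. -/
theorem det_maskedMatrix_ratio {S : Finset ι} (hS : S.Nonempty) {w : ι → ℂ} (hw : ∀ x, w x ≠ 0) :
    (maskedMatrix B S (ratio B S w)).det = 0 := by
  rw [← Matrix.exists_vecMul_eq_zero_iff]
  refine ⟨fun x => if x ∈ S then w x else 0, ?_, ?_⟩
  · obtain ⟨x, hx⟩ := hS
    intro h
    have := congrFun h x
    simp [hx, hw x] at this
  · ext y
    simp only [Matrix.vecMul, dotProduct, Pi.zero_apply, ite_mul, zero_mul, Finset.sum_ite_mem,
      Finset.univ_inter, maskedMatrix, Matrix.of_apply]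
    by_cases hy : y ∈ S
    · have : ∀ x ∈ S, w x * (if x ∈ S ∧ y ∈ S then
          (Matrix.diagonal (ratio B S w) - B) x y else (1 : Matrix ι ι ℂ) x y) =
          w x * (Matrix.diagonal (ratio B S w)) x y - w x * B x y := by
        intro x hx
        rw [if_pos ⟨hx, hy⟩, Matrix.sub_apply, mul_sub]
      rw [Finset.sum_congr rfl this, Finset.sum_sub_distrib, Finset.sum_eq_single_of_mem y hy]
      · rw [Matrix.diagonal_apply_eq, ratio, Finset.mul_sum, sub_eq_zero]
        refine Finset.sum_congr rfl fun x _ => ?_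
        have := hw y
        field_simp
      · intro x _ hxy
        rw [Matrix.diagonal_apply_ne _ hxy, mul_zero]
    · refine Finset.sum_eq_zero fun x hx => ?_
      have : x ≠ y := fun h => hy (h ▸ hx)
      simp [hy, this]

theorem differentiable_det {M : (ι → ℂ) → Matrix ι ι ℂ}
    (h : ∀ x y, Differentiable ℂ fun D => M D x y) : Differentiable ℂ fun D => (M D).det := by
  simp only [Matrix.det_apply]
  fun_prop

theorem differentiable_maskedMatrix_apply (S : Finset ι) (x y : ι) :
    Differentiable ℂ fun D => maskedMatrix B S D x y := by
  simp only [maskedMatrix, Matrix.of_apply]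
  split_ifs
  · rcases eq_or_ne x y with rfl | h
    · simp only [Matrix.sub_apply, Matrix.diagonal_apply_eq]
      fun_prop
    · simp [h]
  · exact differentiable_const _

theorem differentiable_adjugate_maskedMatrix (S : Finset ι) (a b : ι) :
    Differentiable ℂ fun D => (maskedMatrix B S D).adjugate a b := by
  simp only [Matrix.adjugate_apply]
  refine differentiable_det fun x y => ?_
  simp only [Matrix.updateRow_apply]
  split_ifs
  · exact differentiable_const _
  · exact differentiable_maskedMatrix_apply B S x y

/-- The torus average giving the total `B`-weight of the words of length `N + 1` from `a` to `b`
whose set of letters is `S`. -/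
def coveringWeight (S : Finset ι) (N : ℕ) (a b : ι) : ℂ :=
  if a ∈ S ∧ b ∈ S then
    ∫ θ, (maskedMatrix B S (ratio B S (phase θ))).adjugate a b *
      holdingWeight S N (ratio B S (phase θ)) ∂torusMeasure ι
  else 0

theorem differentiable_adjugate_mul_holdingWeight (S S' : Finset ι) (N : ℕ) (a b : ι) :
    Differentiable ℂ fun D => (maskedMatrix B S D).adjugate a b * holdingWeight S' N D :=
  (differentiable_adjugate_maskedMatrix B S a b).mul (differentiable_holdingWeight S' N)

/-- The determinant vanishes, so `adj(M) M = 0`; this is its entry `(a,b)`. It trades a factor `D_b`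
for one step of the word into `b`. -/
theorem adjugate_mul_ratio {S : Finset ι} {b : ι} (hb : b ∈ S) (a : ι) {w : ι → ℂ}
    (hw : ∀ x, w x ≠ 0) :
    (maskedMatrix B S (ratio B S w)).adjugate a b * ratio B S w b =
      ∑ y ∈ S, (maskedMatrix B S (ratio B S w)).adjugate a y * B y b := by
  set M := maskedMatrix B S (ratio B S w) with hM
  have h := congrFun (congrFun (Matrix.adjugate_mul M) a) b
  rw [det_maskedMatrix_ratio B ⟨b, hb⟩ hw, zero_smul, Matrix.mul_apply,
    ← Finset.sum_subset (Finset.subset_univ S)] at h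
  · have h' : ∀ y ∈ S, M.adjugate a y * M y b =
        M.adjugate a y * Matrix.diagonal (ratio B S w) y b - M.adjugate a y * B y b := by
      intro y hy
      simp [hM, maskedMatrix, hy, hb, mul_sub]
    rw [Finset.sum_congr rfl h', Finset.sum_sub_distrib, Finset.sum_eq_single_of_mem b hb,
      Matrix.diagonal_apply_eq] at h
    · exact sub_eq_zero.1 h
    · intro y _ hy
      rw [Matrix.diagonal_apply_ne _ hy, mul_zero]
  · intro y _ hy
    have : y ≠ b := fun h => hy (h ▸ hb)
    simp [hM, maskedMatrix, hy, this]

/-- Neither factor depends on `D_b`: the polynomial runs over `S.erase b`, and the adjugate entry is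
expanded along column `b`. Averaging over the phase at `b` therefore removes `b` from the ratios.
For `a = b` what remains is a determinant that vanishes, or, if `S = {b}`, a polynomial of positive
degree in no variables. -/
theorem integral_adjugate_mul_holdingWeight_erase {S : Finset ι} {a b : ι} (ha : a ∈ S)
    (hb : b ∈ S) (N : ℕ) :
    ∫ θ, (maskedMatrix B S (ratio B S (phase θ))).adjugate a b *
        holdingWeight (S.erase b) N (ratio B S (phase θ)) ∂torusMeasure ι =
      ∑ y, coveringWeight B (S.erase b) N a y * B y b := by
  have hcongr : ∀ D D' : ι → ℂ, (∀ x ≠ b, D x = D' x) → ∀ x ∈ S.erase b, D x = D' x :=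
    fun D D' h x hx => h x (Finset.ne_of_mem_erase hx)
  rcases eq_or_ne a b with rfl | hab
  · have hr : ∑ y, coveringWeight B (S.erase a) N a y * B y a = 0 := by
      simp [coveringWeight]
    rw [hr]
    simp only [adjugate_self_eq_det_isolate, isolate_maskedMatrix]
    rw [integral_ratio_erase B S a ha
      (Q := fun D => (maskedMatrix B (S.erase a) D).det * holdingWeight (S.erase a) N D)]
    · rcases (S.erase a).eq_empty_or_nonempty with h | h
      · simp [h, holdingWeight_empty]
      · simp [det_maskedMatrix_ratio B h (phase_ne_zero _)]
    · exact (differentiable_det (differentiable_maskedMatrix_apply B _)).mul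
        (differentiable_holdingWeight _ N)
    · intro D D' h
      rw [maskedMatrix_congr B (hcongr D D' h), holdingWeight_congr N (hcongr D D' h)]
  · have h1 : ∀ D, (maskedMatrix B S D).adjugate a b =
        ∑ y ∈ S.erase b, (maskedMatrix B (S.erase b) D).adjugate a y * B y b := by
      intro D
      rw [adjugate_eq_sum_isolate _ hab, isolate_maskedMatrix, ← Finset.sum_neg_distrib]
      symm
      refine Finset.sum_subset_zero_on_sdiff (Finset.erase_subset_erase b (Finset.subset_univ S))
        ?_ ?_
      · intro y hy
        simp only [Finset.mem_sdiff, Finset.mem_erase, Finset.mem_univ, and_true, not_and] at hy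
        simp [maskedMatrix, hy.2 hy.1, hy.1]
      · intro y hy
        have := Finset.mem_erase.1 hy
        simp [maskedMatrix, this.1, this.2, hb]
    simp only [h1]
    rw [integral_ratio_erase B S b hb
      (Q := fun D => (∑ y ∈ S.erase b, (maskedMatrix B (S.erase b) D).adjugate a y * B y b) *
        holdingWeight (S.erase b) N D)]
    · simp only [Finset.sum_mul]
      rw [integral_finsetSum]
      · rw [← Finset.sum_subset (Finset.subset_univ (S.erase b))]
        · refine Finset.sum_congr rfl fun y hy => ?_
          rw [coveringWeight, if_pos ⟨Finset.mem_erase.2 ⟨hab, ha⟩, hy⟩, ← integral_mul_const]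
          refine integral_congr_ae (ae_of_all _ fun θ => ?_)
          ring
        · intro y _ hy
          simp [coveringWeight, hy]
      · intro y _
        exact integrable_comp_ratio_phase B (S.erase b)
          (((differentiable_adjugate_maskedMatrix B (S.erase b) a y).mul_const (B y b)).mul
            (differentiable_holdingWeight (S.erase b) N))
    · refine Differentiable.mul (Differentiable.fun_sum fun y _ => ?_)
        (differentiable_holdingWeight _ N)
      exact (differentiable_adjugate_maskedMatrix B _ a y).mul_const _
    · intro D D' h
      rw [maskedMatrix_congr B (hcongr D D' h), holdingWeight_congr N (hcongr D D' h)]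

/-- Decomposition by the last letter: the word deprived of its final `b` covers either `S` or
`S.erase b`. The two cases are the two terms of `holdingWeight_succ`. -/
theorem coveringWeight_succ {S : Finset ι} {b : ι} (hb : b ∈ S) (N : ℕ) (a : ι) :
    coveringWeight B S (N + 1) a b =
      ∑ y, (coveringWeight B S N a y + coveringWeight B (S.erase b) N a y) * B y b := by
  by_cases ha : a ∈ S
  · simp only [add_mul, Finset.sum_add_distrib]
    rw [← integral_adjugate_mul_holdingWeight_erase B ha hb, coveringWeight, if_pos ⟨ha, hb⟩]
    have h1 : ∀ θ : ι → ℝ, (maskedMatrix B S (ratio B S (phase θ))).adjugate a b *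
        holdingWeight S (N + 1) (ratio B S (phase θ)) =
        (∑ y ∈ S, (maskedMatrix B S (ratio B S (phase θ))).adjugate a y *
          holdingWeight S N (ratio B S (phase θ)) * B y b) +
        (maskedMatrix B S (ratio B S (phase θ))).adjugate a b *
          holdingWeight (S.erase b) N (ratio B S (phase θ)) := by
      intro θ
      rw [holdingWeight_succ hb, mul_add, ← mul_assoc,
        adjugate_mul_ratio B hb a (phase_ne_zero θ), Finset.sum_mul]
      congr 1
      refine Finset.sum_congr rfl fun y _ => ?_
      ring
    simp only [h1]
    have hi : ∀ y ∈ S, Integrable (fun θ => (maskedMatrix B S (ratio B S (phase θ))).adjugate a y *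
          holdingWeight S N (ratio B S (phase θ)) * B y b) (torusMeasure ι) := fun y _ =>
      integrable_comp_ratio_phase B S
        ((differentiable_adjugate_mul_holdingWeight B S S N a y).mul_const (B y b))
    rw [integral_add (integrable_finsetSum _ hi), integral_finsetSum _ hi]
    · congr 1
      rw [← Finset.sum_subset (Finset.subset_univ S)]
      · refine Finset.sum_congr rfl fun y hy => ?_
        rw [integral_mul_const, coveringWeight, if_pos ⟨ha, hy⟩]
      · intro y _ hy
        simp [coveringWeight, hy]
    · exact integrable_comp_ratio_phase B S
        (differentiable_adjugate_mul_holdingWeight B S (S.erase b) N a b)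
  · simp [coveringWeight, ha]

theorem coveringWeight_zero (S : Finset ι) (a b : ι) :
    coveringWeight B S 0 a b = if S = {a} ∧ a = b then 1 else 0 := by
  by_cases h : S = {a} ∧ a = b
  · obtain ⟨rfl, rfl⟩ := h
    simp [coveringWeight, holdingWeight, completeHomogeneous_zero, adjugate_self_eq_det_isolate,
      isolate_maskedMatrix, maskedMatrix_empty]
  · rw [if_neg h, coveringWeight]
    split_ifs with hab
    · have : ¬ S.card ≤ 0 + 1 := by
        intro hc
        have h1 := Finset.card_le_one.1 hc
        exact h ⟨Finset.eq_singleton_iff_unique_mem.2 ⟨hab.1, fun x hx => h1 x hx a hab.1⟩,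
          h1 a hab.1 b hab.2⟩
      simp [holdingWeight, this]
    · rfl

/-- Every word with letters in `S` has exactly one set of letters. In the induction, subsets are
split by whether they contain `b`; those that do not contribute nothing, and `coveringWeight_succ`
at `insert b S'` brings back both halves of the powerset. This identity later determines the
covering weights by inclusion-exclusion. -/
theorem sum_powerset_coveringWeight (S : Finset ι) (N : ℕ) (a b : S) :
    ∑ S' ∈ S.powerset, coveringWeight B S' N a b =
      ((B.submatrix (fun x : S => (x : ι)) (fun x : S => (x : ι))) ^ N) a b := by
  induction N generalizing b with
  | zero =>
    simp only [coveringWeight_zero, pow_zero, Matrix.one_apply]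
    by_cases h : a = b
    · subst h
      simp [Finset.sum_ite_eq']
    · have : (a : ι) ≠ b := fun h' => h (Subtype.ext h')
      simp [h, this]
  | succ N ih =>
    have hzero : ∀ S' ∈ (S.erase (b : ι)).powerset, coveringWeight B S' (N + 1) a b = 0 := by
      intro S' hS'
      have : (b : ι) ∉ S' := fun h =>
        Finset.notMem_erase (b : ι) S (Finset.mem_powerset.1 hS' h)
      simp [coveringWeight, this]
    have hins : ∀ S' ∈ (S.erase (b : ι)).powerset,
        coveringWeight B (insert (b : ι) S') (N + 1) a b =
          ∑ y, (coveringWeight B (insert (b : ι) S') N a y + coveringWeight B S' N a y) *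
            B y b := by
      intro S' hS'
      have : (b : ι) ∉ S' := fun h =>
        Finset.notMem_erase (b : ι) S (Finset.mem_powerset.1 hS' h)
      rw [coveringWeight_succ B (Finset.mem_insert_self _ _), Finset.erase_insert this]
    have hsum : ∀ f : Finset ι → ℂ, ∑ S' ∈ S.powerset, f S' =
        ∑ S' ∈ (S.erase (b : ι)).powerset, f S' +
          ∑ S' ∈ (S.erase (b : ι)).powerset, f (insert (b : ι) S') := by
      intro f
      rw [← Finset.sum_powerset_insert (Finset.notMem_erase (b : ι) S),
        Finset.insert_erase b.2]
    rw [hsum, Finset.sum_eq_zero hzero, zero_add, Finset.sum_congr rfl hins, Finset.sum_comm,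
      pow_succ, Matrix.mul_apply]
    simp only [← Finset.sum_mul, Finset.sum_add_distrib]
    have hy : ∀ y : ι, (∑ S' ∈ (S.erase (b : ι)).powerset,
        coveringWeight B (insert (b : ι) S') N a y +
        ∑ S' ∈ (S.erase (b : ι)).powerset, coveringWeight B S' N a y) =
        ∑ S' ∈ S.powerset, coveringWeight B S' N a y := by
      intro y
      rw [hsum, add_comm]
    simp only [hy]
    rw [← Finset.sum_subset (Finset.subset_univ S), ← Finset.sum_coe_sort S]
    · refine Finset.sum_congr rfl fun y _ => ?_
      rw [ih y, Matrix.submatrix_apply]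
    · intro y _ hyS
      rw [Finset.sum_eq_zero, zero_mul]
      intro S' hS'
      have : y ∉ S' := fun h => hyS (Finset.mem_powerset.1 hS' h)
      simp [coveringWeight, this]

end Covering

/-! ### The differential operator acting on exponential averages -/

section DifferentialOperator

variable {ι : Type*} [Fintype ι]

/-- Iterated derivatives are local, so agreement on an open set suffices. It is used on the open
orthant, where the contour shift applies. -/
theorem foldr_partialDeriv_congr [DecidableEq ι] {U : Set (ι → ℝ)} (hU : IsOpen U)
    {f g : (ι → ℝ) → ℂ} (h : Set.EqOn f g U) (L : List ι) :
    Set.EqOn (L.foldr partialDeriv f) (L.foldr partialDeriv g) U := by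
  induction L with
  | nil => exact h
  | cons x L ih =>
    intro l hl
    exact (Filter.EventuallyEq.lineDeriv_eq (𝕜 := ℝ) (ih.eventuallyEq_of_mem (hU.mem_nhds hl)) :)

theorem diffOp_congr [DecidableEq ι] {U : Set (ι → ℝ)} (hU : IsOpen U)
    {f g : (ι → ℝ) → ℂ} (h : Set.EqOn f g U) (q : MvPolynomial ι ℝ) :
    Set.EqOn (diffOp q f) (diffOp q g) U := by
  intro l hl
  refine Finset.sum_congr rfl fun m _ => ?_
  rw [mixedPartial, mixedPartial, foldr_partialDeriv_congr hU h _ hl]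

/-- The torus average of `φ(θ) exp(∑ l_y D_y(θ))`. -/
def expAverage (D : (ι → ℝ) → ι → ℂ) (φ : (ι → ℝ) → ℂ) (l : ι → ℝ) : ℂ :=
  ∫ θ, φ θ * Complex.exp (∑ y, (l y : ℂ) * D θ y) ∂torusMeasure ι

theorem continuous_exp_sum_mul {D : (ι → ℝ) → ι → ℂ} (hD : Continuous D) (l : ι → ℝ) :
    Continuous fun θ => Complex.exp (∑ y, (l y : ℂ) * D θ y) := by
  have := fun y => (continuous_apply y).comp hD
  simp only [Function.comp_def] at this
  fun_prop

variable [DecidableEq ι]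

theorem partialDeriv_expAverage {D : (ι → ℝ) → ι → ℂ} (hD : Continuous D) {φ : (ι → ℝ) → ℂ}
    (hφ : Continuous φ) (x : ι) :
    partialDeriv x (expAverage D φ) = expAverage D fun θ => φ θ * D θ x := by
  funext l
  have hDx : Continuous fun θ => D θ x := (continuous_apply x).comp hD
  have hE := continuous_exp_sum_mul hD l
  have hsum : ∀ (t : ℝ) θ, ∑ y, (((l + t • (Pi.single x 1 : ι → ℝ)) y : ℝ) : ℂ) * D θ y =
      ∑ y, (l y : ℂ) * D θ y + t * D θ x := by
    intro t θ
    simp only [Pi.add_apply, Pi.smul_apply, smul_eq_mul, Complex.ofReal_add, add_mul,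
      Finset.sum_add_distrib]
    congr 1
    rw [Finset.sum_eq_single x]
    · simp
    · intro y _ hy; simp [hy]
    · simp
  -- Differentiation under the integral along the direction `x` at `t = 0`; for `|t| < 1` the factor
  -- `exp(t D_x)` is at most `exp ‖D_x‖`.
  have key := hasDerivAt_integral_of_dominated_loc_of_deriv_le (μ := torusMeasure ι) (𝕜 := ℝ)
    (F := fun t θ => φ θ * (Complex.exp (∑ y, (l y : ℂ) * D θ y) * Complex.exp (t * D θ x)))
    (F' := fun t θ => φ θ * (Complex.exp (∑ y, (l y : ℂ) * D θ y) *
      (Complex.exp (t * D θ x) * D θ x)))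
    (bound := fun θ => ‖φ θ‖ * (‖Complex.exp (∑ y, (l y : ℂ) * D θ y)‖ *
      (Real.exp ‖D θ x‖ * ‖D θ x‖)))
    (x₀ := 0) (s := Metric.ball 0 1) (Metric.ball_mem_nhds 0 one_pos)
    (Eventually.of_forall fun t => Continuous.aestronglyMeasurable (by fun_prop))
    (integrable_torusMeasure (by fun_prop))
    (Continuous.aestronglyMeasurable (by fun_prop)) ?_
    (integrable_torusMeasure (by fun_prop)) ?_
  · have h := key.2.deriv
    rw [partialDeriv, lineDeriv]
    simp only [expAverage, hsum, Complex.exp_add]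
    rw [h]
    refine integral_congr_ae (ae_of_all _ fun θ => ?_)
    simp
    ring
  · refine ae_of_all _ fun θ t ht => ?_
    simp only [norm_mul]
    gcongr
    rw [Complex.norm_exp]
    refine Real.exp_le_exp.2 ((Complex.re_le_norm _).trans ?_)
    rw [norm_mul, Complex.norm_real]
    have : ‖t‖ ≤ 1 := by simpa using (mem_ball_zero_iff.1 ht).le
    exact mul_le_of_le_one_left (norm_nonneg _) this
  · refine ae_of_all _ fun θ t _ => ?_
    refine HasDerivAt.const_mul _ (HasDerivAt.const_mul _ ?_)
    have h1 : HasDerivAt (fun t : ℝ => (t : ℂ) * D θ x) (D θ x) t := by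
      simpa using (Complex.ofRealCLM.hasDerivAt (x := t)).mul_const (D θ x)
    exact h1.cexp

theorem foldr_partialDeriv_expAverage {D : (ι → ℝ) → ι → ℂ} (hD : Continuous D) (L : List ι) :
    L.foldr partialDeriv (expAverage D fun _ => 1) =
      expAverage D fun θ => (L.map (D θ)).prod := by
  induction L with
  | nil => simp
  | cons x L ih =>
    rw [List.foldr_cons, ih, partialDeriv_expAverage hD]
    · simp [mul_comm]
    · refine continuous_list_prod L fun y _ => (continuous_apply y).comp hD

theorem diffOp_expAverage {D : (ι → ℝ) → ι → ℂ} (hD : Continuous D) (q : MvPolynomial ι ℝ) :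
    diffOp q (expAverage D fun _ => 1) = expAverage D fun θ => MvPolynomial.aeval (D θ) q := by
  funext l
  have hm : ∀ m : ι →₀ ℕ, mixedPartial m (expAverage D fun _ => 1) l =
      ∫ θ, (∏ x ∈ m.support, D θ x ^ m x) * Complex.exp (∑ y, (l y : ℂ) * D θ y)
        ∂torusMeasure ι := by
    intro m
    rw [mixedPartial, foldr_partialDeriv_expAverage hD, expAverage]
    refine integral_congr_ae (ae_of_all _ fun θ => ?_)
    beta_reduce
    congr 1
    rw [← Multiset.prod_coe, ← Multiset.map_coe, Multiset.coe_toList, Finsupp.toMultiset_map,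
      Finsupp.prod_toMultiset, Finsupp.prod_mapDomain_index (by simp) (by simp [pow_add])]
    rfl
  simp only [diffOp, hm, expAverage, MvPolynomial.aeval_def, MvPolynomial.eval₂_eq,
    Finset.sum_mul]
  rw [integral_finsetSum]
  · refine Finset.sum_congr rfl fun m _ => ?_
    rw [← integral_const_mul]
    refine integral_congr_ae (ae_of_all _ fun θ => ?_)
    simp [mul_assoc]
  · intro m _
    refine integrable_torusMeasure (Continuous.mul (Continuous.mul continuous_const ?_)
      (continuous_exp_sum_mul hD l))
    exact continuous_finsetProd _ fun x _ => ((continuous_apply x).comp hD).pow _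

end DifferentialOperator

/-! ### The density as a torus average -/

section Density

variable {ι : Type*} [Fintype ι] [DecidableEq ι]

/-- The torus average of `adj(diag D - B)_{ab} exp(∑ l_y D_y)`. -/
def entireDensity (B : Matrix ι ι ℂ) (a b : ι) : (ι → ℝ) → ℂ :=
  expAverage (fun θ => ratio B Finset.univ (phase θ)) fun θ =>
    (Matrix.diagonal (ratio B Finset.univ (phase θ)) - B).adjugate a b

/-- Contour shift with radii `√l_x`: since `l_y = √l_y √l_y`, multiplying the shifted ratio at `y`
by `l_y` gives exactly the terms `A_{xy} √l_x √l_y e^{i(θ_x - θ_y)}`. The square roots disappear, so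
the derivatives become explicit. -/
theorem angularIntegral_eq_expAverage (A : Matrix ι ι ℝ) {l : ι → ℝ} (hl : ∀ x, 0 < l x) :
    angularIntegral A l = expAverage
      (fun θ => ratio (A.map Complex.ofReal) Finset.univ (phase θ)) (fun _ => 1) l := by
  have h := integral_ratio_smul_phase (A.map Complex.ofReal)
    (Q := fun D => Complex.exp (∑ y, (l y : ℂ) * D y)) (by fun_prop) (fun x => √(l x))
    (fun x => Real.sqrt_pos.2 (hl x))
  simp only [expAverage, one_mul]
  rw [← h, angularIntegral, integral_torusMeasure]
  congr 1
  refine integral_congr_ae (ae_of_all _ fun θ => ?_)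
  beta_reduce
  congr 1
  rw [Finset.sum_comm]
  refine Finset.sum_congr rfl fun y _ => ?_
  rw [ratio, Finset.mul_sum]
  refine Finset.sum_congr rfl fun x _ => ?_
  have h1 : (√(l y) : ℂ) ≠ 0 := by exact_mod_cast (Real.sqrt_pos.2 (hl y)).ne'
  have h2 : (l y : ℂ) = √(l y) * √(l y) := by
    exact_mod_cast (Real.mul_self_sqrt (hl y).le).symm
  rw [h2, mul_sub, Complex.exp_sub, Matrix.map_apply]
  change _ * (phase θ x / phase θ y) = _
  have h3 := phase_ne_zero θ y
  field_simp

theorem aeval_cofactor_symbolMatrix (A : Matrix ι ι ℝ) (a b : ι) (D : ι → ℂ) :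
    MvPolynomial.aeval D (cofactor a b (symbolMatrix (-A))) =
      (Matrix.diagonal D - A.map Complex.ofReal).adjugate a b := by
  rw [← cofactor_eq_adjugate, cofactor, cofactor, AlgHom.map_det]
  congr 1
  ext x y
  simp only [AlgHom.mapMatrix_apply, Matrix.map_apply, Matrix.of_apply, map_add]
  congr 1
  · split_ifs with h
    · rcases eq_or_ne x y with rfl | hxy
      · simp [symbolMatrix]
        ring
      · simp [symbolMatrix, hxy]
    · simp
  · split_ifs <;> simp

theorem density_eq_entireDensity (A : Matrix ι ι ℝ) (a b : ι) {l : ι → ℝ} (hl : ∀ x, 0 < l x) :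
    density A a b l = entireDensity (A.map Complex.ofReal) a b l := by
  have hU : IsOpen {l : ι → ℝ | ∀ x, 0 < l x} := by
    simp only [Set.ofPred_forall]
    exact isOpen_iInter_of_finite fun x => isOpen_lt continuous_const (continuous_apply x)
  rw [density, diffOp_congr hU (fun l hl => angularIntegral_eq_expAverage A hl) _ hl,
    diffOp_expAverage (continuous_ratio_phase _ _)]
  simp only [aeval_cofactor_symbolMatrix, entireDensity]

theorem continuous_adjugate_ratio_phase (B : Matrix ι ι ℂ) (a b : ι) : Continuous fun θ : ι → ℝ =>
    (Matrix.diagonal (ratio B Finset.univ (phase θ)) - B).adjugate a b := by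
  simp only [← maskedMatrix_univ]
  exact (differentiable_adjugate_maskedMatrix B Finset.univ a b).continuous.comp
    (continuous_ratio_phase B Finset.univ)

/-- Adding a diagonal matrix to the generator tilts the density exponentially. -/
theorem entireDensity_add_diagonal (B : Matrix ι ι ℂ) (v : ι → ℂ) (a b : ι) (l : ι → ℝ) :
    entireDensity (B + Matrix.diagonal v) a b l =
      Complex.exp (∑ y, (l y : ℂ) * v y) * entireDensity B a b l := by
  have h : ∀ θ, ratio (B + Matrix.diagonal v) Finset.univ (phase θ) =
      ratio B Finset.univ (phase θ) + v := by
    intro θ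
    funext y
    simp only [ratio, Matrix.add_apply, mul_add, add_mul, Finset.sum_add_distrib, Pi.add_apply]
    congr 1
    rw [Finset.sum_eq_single y]
    · have := phase_ne_zero θ y
      rw [Matrix.diagonal_apply_eq]
      field_simp
    · intro x _ hx
      simp [hx]
    · simp
  simp only [entireDensity, expAverage]
  rw [← integral_const_mul]
  refine integral_congr_ae (ae_of_all _ fun θ => ?_)
  beta_reduce
  have hd : Matrix.diagonal (ratio B Finset.univ (phase θ) + v) =
      Matrix.diagonal (ratio B Finset.univ (phase θ)) + Matrix.diagonal v :=
    (Matrix.diagonal_add _ _).symm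
  rw [h, hd, add_sub_add_right_eq_sub]
  simp only [Pi.add_apply, mul_add, Finset.sum_add_distrib, Complex.exp_add]
  ring

end Density

/-! ### Dirichlet integrals and the total mass of the density -/

section Simplex

variable {ι : Type*} [Fintype ι]

theorem measurableSet_openSimplex (T : ℝ) : MeasurableSet (openSimplex ι T) := by
  have h : MeasurableSet {l : ι → ℝ | ∀ x, 0 < l x} := by
    simp only [Set.ofPred_forall]
    exact MeasurableSet.iInter fun x => measurableSet_lt measurable_const (measurable_pi_apply x)
  exact h.inter (measurableSet_eq_fun (by fun_prop) measurable_const)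

/-- The density `∏ l_x ^ {k_x} / k_x!`. -/
def dividedMonomial (k : ι → ℕ) (l : ι → ℝ) : ℝ := ∏ x, l x ^ k x / (k x).factorial

theorem continuous_dividedMonomial (k : ι → ℕ) : Continuous (dividedMonomial k) := by
  unfold dividedMonomial
  fun_prop

theorem dividedMonomial_nonneg (k : ι → ℕ) {l : ι → ℝ} (hl : ∀ x, 0 ≤ l x) :
    0 ≤ dividedMonomial k l :=
  Finset.prod_nonneg fun x _ => div_nonneg (pow_nonneg (hl x) _) (Nat.cast_nonneg _)

theorem integral_exp_neg_mul_pow (n : ℕ) :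
    IntegrableOn (fun t : ℝ => Real.exp (-t) * t ^ n) (Set.Ioi 0) ∧
      ∫ t in Set.Ioi (0 : ℝ), Real.exp (-t) * t ^ n = n.factorial := by
  have hn : (0 : ℝ) < n + 1 := by positivity
  have h1 := Real.GammaIntegral_convergent hn
  have h2 := Real.Gamma_eq_integral hn
  simp only [add_sub_cancel_right, Real.rpow_natCast] at h1 h2
  exact ⟨h1, h2 ▸ Real.Gamma_nat_eq_factorial n⟩

theorem lintegral_orthant_exp_neg_mul_dividedMonomial (k : ι → ℕ) :
    ∫⁻ l in {l : ι → ℝ | ∀ x, 0 < l x},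
      ENNReal.ofReal (Real.exp (-∑ x, l x) * dividedMonomial k l) = 1 := by
  have hset : {l : ι → ℝ | ∀ x, 0 < l x} = Set.univ.pi fun _ => Set.Ioi 0 := by
    ext l; simp
  have hprod : ∀ l : ι → ℝ, Real.exp (-∑ x, l x) * dividedMonomial k l =
      ∏ x, (Real.exp (-l x) * l x ^ k x / (k x).factorial) := by
    intro l
    rw [← Finset.sum_neg_distrib, Real.exp_sum, dividedMonomial, ← Finset.prod_mul_distrib]
    simp only [mul_div_assoc]
  have hint : Integrable (fun l : ι → ℝ => ∏ x, (Real.exp (-l x) * l x ^ k x / (k x).factorial))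
      (Measure.pi fun _ : ι => (volume : Measure ℝ).restrict (Set.Ioi 0)) :=
    Integrable.fintype_prod (f := fun x (t : ℝ) => Real.exp (-t) * t ^ k x / (k x).factorial)
      fun x => (integral_exp_neg_mul_pow (k x)).1.div_const _
  simp only [hprod]
  rw [hset, volume_pi, Measure.restrict_pi_pi, ← ofReal_integral_eq_lintegral_ofReal hint,
    integral_fintype_prod_eq_prod (f := fun x (t : ℝ) => Real.exp (-t) * t ^ k x / (k x).factorial)]
  · have : ∀ x, ∫ t in Set.Ioi (0 : ℝ), Real.exp (-t) * t ^ k x / (k x).factorial = 1 := by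
      intro x
      rw [integral_div, (integral_exp_neg_mul_pow (k x)).2, div_self]
      exact_mod_cast (Nat.factorial_pos _).ne'
    simp [this]
  · rw [← Measure.restrict_pi_pi]
    filter_upwards [ae_restrict_mem (MeasurableSet.univ_pi fun _ => measurableSet_Ioi)] with l hl
    refine Finset.prod_nonneg fun x _ => ?_
    have : 0 < l x := hl x (Set.mem_univ x)
    positivity

theorem smul_mem_openSimplex {T : ℝ} (hT : 0 < T) (l : ι → ℝ) :
    T • l ∈ openSimplex ι T ↔ l ∈ openSimplex ι 1 := by
  simp only [openSimplex, Set.mem_ofPred_eq, Pi.smul_apply, smul_eq_mul, ← Finset.mul_sum,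
    mul_pos_iff_of_pos_left hT, mul_eq_left₀ hT.ne']

theorem norm_sum_mul_le {T : ℝ} {l : ι → ℝ} (hl : l ∈ openSimplex ι T) (D : ι → ℂ) :
    ‖∑ y, (l y : ℂ) * D y‖ ≤ T * ∑ y, ‖D y‖ := by
  refine (norm_sum_le _ _).trans ?_
  rw [Finset.mul_sum]
  refine Finset.sum_le_sum fun y _ => ?_
  rw [norm_mul, Complex.norm_real, Real.norm_of_nonneg (hl.1 y).le]
  refine mul_le_mul_of_nonneg_right ?_ (norm_nonneg _)
  rw [← hl.2]
  exact Finset.single_le_sum (fun y _ => (hl.1 y).le) (Finset.mem_univ y)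

variable [DecidableEq ι]

theorem ae_simplexMeasure_mem (c : ι) (T : ℝ) : ∀ᵐ l ∂simplexMeasure c T, l ∈ openSimplex ι T :=
  ae_restrict_mem (measurableSet_openSimplex T)

theorem lintegral_simplexMeasure_eq (c : ι) (T : ℝ) {F : (ι → ℝ) → ℝ≥0∞} (hF : Measurable F) :
    ∫⁻ l, F l ∂simplexMeasure c T =
      ∫⁻ u, (openSimplex ι T).indicator F (hyperplanePoint c T u) := by
  rw [simplexMeasure, ← lintegral_indicator (measurableSet_openSimplex T),
    lintegral_map (hF.indicator (measurableSet_openSimplex T)) (measurable_hyperplanePoint c T)]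

theorem hyperplanePoint_smul (c : ι) (T : ℝ) (u : {x : ι // x ≠ c} → ℝ) :
    hyperplanePoint c T (T • u) = T • hyperplanePoint c 1 u := by
  funext x
  by_cases h : x = c
  · simp [hyperplanePoint, h, mul_sub, Finset.mul_sum]
  · simp [hyperplanePoint, h]

theorem lintegral_simplexMeasure_scale (c : ι) {T : ℝ} (hT : 0 < T) {F : (ι → ℝ) → ℝ≥0∞}
    (hF : Measurable F) :
    ∫⁻ l, F l ∂simplexMeasure c T =
      ENNReal.ofReal (T ^ Fintype.card {x : ι // x ≠ c}) *
        ∫⁻ l, F (T • l) ∂simplexMeasure c 1 := by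
  set d := Fintype.card {x : ι // x ≠ c}
  have hFT : Measurable fun l : ι → ℝ => F (T • l) := hF.comp (measurable_const_smul T)
  rw [lintegral_simplexMeasure_eq c T hF, lintegral_simplexMeasure_eq c 1 hFT]
  have hmap := Measure.map_addHaar_smul (volume : Measure ({x : ι // x ≠ c} → ℝ)) hT.ne'
  have hG : Measurable fun u => (openSimplex ι T).indicator F (hyperplanePoint c T u) :=
    (hF.indicator (measurableSet_openSimplex T)).comp (measurable_hyperplanePoint c T)
  have h1 : ∫⁻ u : {x : ι // x ≠ c} → ℝ, (openSimplex ι 1).indicator (fun l => F (T • l))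
      (hyperplanePoint c 1 u) = ∫⁻ u, (openSimplex ι T).indicator F (hyperplanePoint c T u)
        ∂(Measure.map (T • ·) (volume : Measure ({x : ι // x ≠ c} → ℝ))) := by
    rw [lintegral_map hG (measurable_const_smul T)]
    refine lintegral_congr fun u => ?_
    rw [hyperplanePoint_smul]
    by_cases h : hyperplanePoint c 1 u ∈ openSimplex ι 1
    · rw [Set.indicator_of_mem h, Set.indicator_of_mem ((smul_mem_openSimplex hT _).2 h)]
    · rw [Set.indicator_of_notMem h,
        Set.indicator_of_notMem fun h' => h ((smul_mem_openSimplex hT _).1 h')]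
  rw [h1, hmap, lintegral_smul_measure, smul_eq_mul, ← mul_assoc, Module.finrank_pi,
    ← ENNReal.ofReal_mul (by positivity), abs_of_nonneg (by positivity),
    mul_inv_cancel₀ (by positivity), ENNReal.ofReal_one, one_mul]

/-- The Dirichlet integral. -/
theorem lintegral_dividedMonomial_simplexMeasure (c : ι) {T : ℝ} (hT : 0 < T) (k : ι → ℕ) :
    ∫⁻ l, ENNReal.ofReal (dividedMonomial k l) ∂simplexMeasure c T =
      ENNReal.ofReal (T ^ (∑ x, k x + Fintype.card {x : ι // x ≠ c}) /
        (∑ x, k x + Fintype.card {x : ι // x ≠ c}).factorial) := by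
  set d := Fintype.card {x : ι // x ≠ c}
  have hm : Measurable fun l => ENNReal.ofReal (dividedMonomial k l) :=
    (continuous_dividedMonomial k).measurable.ennreal_ofReal
  set I := ∫⁻ l, ENNReal.ofReal (dividedMonomial k l) ∂simplexMeasure c 1 with hI
  have hscale : ∀ {T : ℝ}, 0 < T → ∫⁻ l, ENNReal.ofReal (dividedMonomial k l) ∂simplexMeasure c T =
      ENNReal.ofReal (T ^ (∑ x, k x + d)) * I := by
    intro T hT
    have : ∀ l : ι → ℝ, ENNReal.ofReal (dividedMonomial k (T • l)) =
        ENNReal.ofReal (T ^ ∑ x, k x) * ENNReal.ofReal (dividedMonomial k l) := by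
      intro l
      rw [← ENNReal.ofReal_mul (by positivity), dividedMonomial, dividedMonomial,
        ← Finset.prod_pow_eq_pow_sum, ← Finset.prod_mul_distrib]
      simp only [Pi.smul_apply, smul_eq_mul, mul_pow, mul_div_assoc]
    rw [lintegral_simplexMeasure_scale c hT hm]
    simp only [this]
    rw [lintegral_const_mul _ hm, ← mul_assoc, ← ENNReal.ofReal_mul (by positivity), pow_add,
      mul_comm (T ^ d)]
  -- Scaling gives the dependence on `T`, leaving the constant `I`. Integrating against `exp(-∑
  -- l_x)` over the orthant and disintegrating yields `1 = (∑ k_x + d)! · I`.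
  have htot := lintegral_orthant_exp_neg_mul_dividedMonomial k
  have hcont : Continuous fun l : ι → ℝ => Real.exp (-∑ x, l x) * dividedMonomial k l :=
    Continuous.mul (by fun_prop) (continuous_dividedMonomial k)
  rw [lintegral_simplexMeasure c _ hcont.measurable.ennreal_ofReal] at htot
  have hinner : ∀ T ∈ Set.Ioi (0 : ℝ),
      ∫⁻ l, ENNReal.ofReal (Real.exp (-∑ x, l x) * dividedMonomial k l) ∂simplexMeasure c T =
        ENNReal.ofReal (Real.exp (-T) * T ^ (∑ x, k x + d)) * I := by
    intro T hT
    have hT : 0 < T := hT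
    rw [ENNReal.ofReal_mul (by positivity), mul_assoc, ← hscale hT, ← lintegral_const_mul _ hm]
    refine lintegral_congr_ae ?_
    filter_upwards [ae_simplexMeasure_mem c T] with l hl
    rw [hl.2, ENNReal.ofReal_mul (by positivity)]
  obtain ⟨hi, hv⟩ := integral_exp_neg_mul_pow (∑ x, k x + d)
  rw [setLIntegral_congr_fun measurableSet_Ioi hinner, lintegral_mul_const _ (by fun_prop),
    ← ofReal_integral_eq_lintegral_ofReal hi
      ((ae_restrict_mem measurableSet_Ioi).mono fun t ht => by
        have : (0 : ℝ) < t := ht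
        positivity), hv] at htot
  rw [hscale hT, div_eq_mul_inv, ENNReal.ofReal_mul (by positivity),
    ENNReal.ofReal_inv_of_pos (by positivity),
    ENNReal.eq_inv_of_mul_eq_one_left ((mul_comm _ _).trans htot)]

instance (c : ι) (T : ℝ) : IsFiniteMeasure (simplexMeasure c T) := by
  by_cases hT : 0 < T
  · constructor
    have := lintegral_dividedMonomial_simplexMeasure c hT 0
    simp only [dividedMonomial, Pi.zero_apply, pow_zero, Nat.factorial_zero, Nat.cast_one, div_one,
      Finset.prod_const_one, ENNReal.ofReal_one, lintegral_one] at this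
    rw [this]
    exact ENNReal.ofReal_lt_top
  · have : openSimplex ι T = ∅ := by
      refine Set.eq_empty_of_forall_notMem fun l hl => hT ?_
      rw [← hl.2]
      exact Finset.sum_pos (fun x _ => hl.1 x) ⟨c, Finset.mem_univ c⟩
    rw [simplexMeasure, this, Measure.restrict_empty]
    infer_instance

theorem integral_dividedMonomial_simplexMeasure (c : ι) {T : ℝ} (hT : 0 < T) (k : ι → ℕ) :
    ∫ l, dividedMonomial k l ∂simplexMeasure c T =
      T ^ (∑ x, k x + Fintype.card {x : ι // x ≠ c}) /
        (∑ x, k x + Fintype.card {x : ι // x ≠ c}).factorial := by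
  rw [integral_eq_lintegral_of_nonneg_ae, lintegral_dividedMonomial_simplexMeasure c hT,
    ENNReal.toReal_ofReal (by positivity)]
  · filter_upwards [ae_simplexMeasure_mem c T] with l hl
    exact dividedMonomial_nonneg k fun x => (hl.1 x).le
  · exact (continuous_dividedMonomial k).aestronglyMeasurable

theorem integrable_simplexMeasure_of_continuous {E : Type*} [NormedAddCommGroup E]
    {f : (ι → ℝ) → E} (hf : Continuous f) (c : ι) (T : ℝ) : Integrable f (simplexMeasure c T) := by
  have hc : IsCompact (Set.univ.pi fun _ : ι => Set.Icc (0 : ℝ) T) :=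
    isCompact_univ_pi fun _ => isCompact_Icc
  obtain ⟨C, hC⟩ := hc.exists_bound_of_continuousOn hf.continuousOn
  refine Integrable.of_bound hf.aestronglyMeasurable C ?_
  filter_upwards [ae_simplexMeasure_mem c T] with l hl
  refine hC l fun x _ => ⟨(hl.1 x).le, ?_⟩
  rw [← hl.2]
  exact Finset.single_le_sum (fun y _ => (hl.1 y).le) (Finset.mem_univ x)

/-- The multinomial theorem turns the divided power into a sum of `D^k` times divided monomials.
Their Dirichlet integrals depend only on the degree `n`, so they factor out and leave the complete
homogeneous polynomial. -/
theorem integral_pow_simplexMeasure (c : ι) {T : ℝ} (hT : 0 < T) (D : ι → ℂ) (n : ℕ) :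
    ∫ l, (∑ y, (l y : ℂ) * D y) ^ n / n.factorial ∂simplexMeasure c T =
      completeHomogeneous Finset.univ n D * ((T : ℂ) ^ (n + Fintype.card {x : ι // x ≠ c}) /
        (n + Fintype.card {x : ι // x ≠ c}).factorial) := by
  have hexp : ∀ l : ι → ℝ, (∑ y, (l y : ℂ) * D y) ^ n / n.factorial =
      ∑ k ∈ Finset.univ.piAntidiag n, (∏ x, D x ^ k x) * (dividedMonomial k l : ℂ) := by
    intro l
    rw [Finset.sum_pow_eq_sum_piAntidiag, Finset.sum_div]
    refine Finset.sum_congr rfl fun k hk => ?_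
    have hkn : ∑ x, k x = n := (Finset.mem_piAntidiag.1 hk).1
    have h1 : (∏ x, ((k x).factorial : ℂ)) * Nat.multinomial Finset.univ k = n.factorial := by
      have := Nat.multinomial_spec Finset.univ k
      rw [hkn] at this
      exact_mod_cast this
    have h2 : (∏ x, ((k x).factorial : ℂ)) ≠ 0 :=
      Finset.prod_ne_zero_iff.2 fun x _ => by exact_mod_cast (Nat.factorial_pos _).ne'
    have h3 : (n.factorial : ℂ) ≠ 0 := by exact_mod_cast (Nat.factorial_pos _).ne'
    simp only [dividedMonomial, Complex.ofReal_prod, Complex.ofReal_div, Complex.ofReal_pow,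
      Complex.ofReal_natCast, mul_pow, Finset.prod_mul_distrib, Finset.prod_div_distrib]
    field_simp
    rw [← h1]
    ring
  simp only [hexp]
  rw [integral_finsetSum]
  · rw [completeHomogeneous, Finset.sum_mul]
    refine Finset.sum_congr rfl fun k hk => ?_
    have hkn : ∑ x, k x = n := (Finset.mem_piAntidiag.1 hk).1
    rw [integral_const_mul, integral_complex_ofReal, integral_dividedMonomial_simplexMeasure c hT,
      hkn]
    push_cast
    rfl
  · intro k _
    exact (integrable_simplexMeasure_of_continuous
      (continuous_dividedMonomial k) c T).ofReal.const_mul _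

/-- The density is integrable on the simplex, and its total mass is a power series in `T`. -/
theorem integrable_and_hasSum_integral_entireDensity (B : Matrix ι ι ℂ) (a b c : ι)
    {T : ℝ} (hT : 0 < T) :
    Integrable (entireDensity B a b) (simplexMeasure c T) ∧
    HasSum (fun N : ℕ => (T : ℂ) ^ N / N.factorial * coveringWeight B Finset.univ N a b)
      (∫ l, entireDensity B a b l ∂simplexMeasure c T) := by
  set d := Fintype.card {x : ι // x ≠ c} with hd
  have hcard : (Finset.univ : Finset ι).card = d + 1 := by
    rw [hd, Finset.card_univ, Fintype.card_subtype_compl, Fintype.card_subtype_eq]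
    have : 0 < Fintype.card ι := Fintype.card_pos_iff.2 ⟨c⟩
    omega
  let D : (ι → ℝ) → ι → ℂ := fun θ => ratio B Finset.univ (phase θ)
  let φ : (ι → ℝ) → ℂ := fun θ => (Matrix.diagonal (D θ) - B).adjugate a b
  have hD : ∀ y, Continuous fun θ => D θ y := fun y =>
    (continuous_apply y).comp (continuous_ratio_phase B Finset.univ)
  have hφ : Continuous φ := continuous_adjugate_ratio_phase B a b
  let M : (ι → ℝ) → ℝ := fun θ => T * ∑ y, ‖D θ y‖
  have hM : Continuous M := by fun_prop
  let μ := (simplexMeasure c T).prod (torusMeasure ι)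
  have hmem : ∀ᵐ q ∂μ, q.1 ∈ openSimplex ι T :=
    Measure.quasiMeasurePreserving_fst.ae (ae_simplexMeasure_mem c T)
  have hexp : ∀ z : ℂ, HasSum (fun n : ℕ => z ^ n / n.factorial) (Complex.exp z) := by
    intro z
    rw [Complex.exp_eq_exp_ℂ]
    exact NormedSpace.expSeries_div_hasSum_exp z
  have hbexp : ∀ θ, HasSum (fun n : ℕ => ‖φ θ‖ * (M θ ^ n / n.factorial))
      (‖φ θ‖ * Real.exp (M θ)) := by
    intro θ
    rw [Real.exp_eq_exp_ℝ]
    exact (NormedSpace.expSeries_div_hasSum_exp (M θ)).mul_left _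
  have hbint : Integrable (fun q : (ι → ℝ) × (ι → ℝ) => ‖φ q.2‖ * Real.exp (M q.2)) μ :=
    (integrable_torusMeasure (by fun_prop : Continuous fun θ => ‖φ θ‖ * Real.exp (M θ))).comp_snd _
  have hfb : ∀ᵐ q ∂μ, ∀ n : ℕ, ‖φ q.2 * ((∑ y, (q.1 y : ℂ) * D q.2 y) ^ n / n.factorial)‖ ≤
      ‖φ q.2‖ * (M q.2 ^ n / n.factorial) := by
    filter_upwards [hmem] with q hq n
    rw [norm_mul, norm_div, norm_pow, Complex.norm_natCast]
    gcongr
    exact norm_sum_mul_le hq _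
  have hcont : ∀ n : ℕ, Continuous fun q : (ι → ℝ) × (ι → ℝ) =>
      φ q.2 * ((∑ y, (q.1 y : ℂ) * D q.2 y) ^ n / n.factorial) := by
    intro n
    fun_prop
  have hsum := hasSum_integral_of_dominated_convergence (μ := μ)
    (F := fun (n : ℕ) (q : (ι → ℝ) × (ι → ℝ)) =>
      φ q.2 * ((∑ y, (q.1 y : ℂ) * D q.2 y) ^ n / n.factorial))
    (f := fun q => φ q.2 * Complex.exp (∑ y, (q.1 y : ℂ) * D q.2 y))
    (fun n q => ‖φ q.2‖ * (M q.2 ^ n / n.factorial))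
    (fun n => (hcont n).aestronglyMeasurable)
    (fun n => hfb.mono fun q hq => hq n)
    (ae_of_all _ fun q => (hbexp q.2).summable)
    (by simpa only [(hbexp _).tsum_eq] using hbint)
    (ae_of_all _ fun q => (hexp _).mul_left _)
  have hintn : ∀ n : ℕ, Integrable (fun q : (ι → ℝ) × (ι → ℝ) =>
      φ q.2 * ((∑ y, (q.1 y : ℂ) * D q.2 y) ^ n / n.factorial)) μ := by
    intro n
    refine hbint.mono' (hcont n).aestronglyMeasurable ?_
    filter_upwards [hfb] with q hq
    refine (hq n).trans ?_
    exact le_hasSum (hbexp q.2) n fun m _ => by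
      have : 0 ≤ M q.2 := mul_nonneg hT.le (Finset.sum_nonneg fun _ _ => norm_nonneg _)
      positivity
  have hintf : Integrable (fun q : (ι → ℝ) × (ι → ℝ) =>
      φ q.2 * Complex.exp (∑ y, (q.1 y : ℂ) * D q.2 y)) μ := by
    refine hbint.mono' (Continuous.aestronglyMeasurable (by fun_prop)) ?_
    filter_upwards [hmem] with q hq
    rw [norm_mul, Complex.norm_exp]
    gcongr
    exact (Complex.re_le_norm _).trans (norm_sum_mul_le hq _)
  have hterm : ∀ n : ℕ, ∫ q, φ q.2 * ((∑ y, (q.1 y : ℂ) * D q.2 y) ^ n / n.factorial) ∂μ =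
      (T : ℂ) ^ (n + d) / (n + d).factorial * coveringWeight B Finset.univ (n + d) a b := by
    intro n
    -- The simplex is integrated first, with the angles fixed. Degree `n` then corresponds to `N = n
    -- + d`, because `N + 1 - card ι = n`.
    rw [integral_prod_symm _ (hintn n)]
    simp only [integral_const_mul, integral_pow_simplexMeasure c hT]
    rw [coveringWeight, if_pos ⟨Finset.mem_univ a, Finset.mem_univ b⟩, ← integral_const_mul]
    refine integral_congr_ae (ae_of_all _ fun θ => ?_)
    simp only [maskedMatrix_univ, holdingWeight, hcard]
    rw [if_pos (by omega), show n + d + 1 - (d + 1) = n by omega]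
    simp only [φ, D, ← hd]
    ring
  rw [integral_prod _ hintf] at hsum
  simp only [hterm] at hsum
  -- The terms with `N < d` are absent from the expansion but vanish anyway: `N + 1` letters cannot
  -- cover `d + 1` states.
  have hinj : Function.Injective fun n : ℕ => n + d := add_left_injective d
  refine ⟨hintf.integral_prod_left, (hinj.hasSum_iff ?_).1 hsum⟩
  intro N hN
  have hNd : N < d := by
    by_contra h
    exact hN ⟨N - d, by simp; omega⟩
  rw [coveringWeight, if_pos ⟨Finset.mem_univ a, Finset.mem_univ b⟩]
  simp [holdingWeight, hcard, show ¬ d ≤ N by omega]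

end Simplex

/-! ### Powers converging to an exponential -/

section PowerLimit

variable {𝔸 : Type*} [NormedRing 𝔸]

/-- Telescoping. It is applied with `M = exp (C / n)`, so that `M ^ n` stays bounded. -/
theorem norm_pow_sub_pow_le [NormOneClass 𝔸] {x z : 𝔸} {M : ℝ} (hM : 1 ≤ M) (hx : ‖x‖ ≤ M)
    (hz : ‖z‖ ≤ M) (n : ℕ) : ‖x ^ n - z ^ n‖ ≤ n * M ^ n * ‖x - z‖ := by
  induction n with
  | zero => simp
  | succ n ih =>
    have hM0 : 0 ≤ M := zero_le_one.trans hM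
    have h1 : x ^ (n + 1) - z ^ (n + 1) = x ^ n * (x - z) + (x ^ n - z ^ n) * z := by
      simp only [pow_succ]; noncomm_ring
    have h2 : ‖x ^ n‖ ≤ M ^ n := (norm_pow_le x n).trans (pow_le_pow_left₀ (norm_nonneg _) hx n)
    have h3 : M ^ n ≤ M ^ (n + 1) := pow_le_pow_right₀ hM (Nat.le_succ n)
    calc ‖x ^ (n + 1) - z ^ (n + 1)‖
        ≤ ‖x ^ n‖ * ‖x - z‖ + ‖x ^ n - z ^ n‖ * ‖z‖ := by
          rw [h1]
          exact (norm_add_le _ _).trans (add_le_add (norm_mul_le _ _) (norm_mul_le _ _))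
      _ ≤ M ^ (n + 1) * ‖x - z‖ + (n * M ^ n * ‖x - z‖) * M := by
          gcongr
          exact h2.trans h3
      _ = ((n + 1 : ℕ) : ℝ) * M ^ (n + 1) * ‖x - z‖ := by
          push_cast; ring

theorem norm_le_exp_of_norm_smul_sub_one_le [NormOneClass 𝔸] [NormedAlgebra ℝ 𝔸] {x : 𝔸} {n : ℕ}
    (hn : 0 < n) {C : ℝ} (h : ‖(n : ℝ) • (x - 1)‖ ≤ C) : ‖x‖ ≤ Real.exp (C / n) := by
  have hn' : (0 : ℝ) < n := by exact_mod_cast hn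
  rw [norm_smul, Real.norm_natCast] at h
  have h1 : ‖x‖ ≤ ‖x - 1‖ + 1 := by
    have := norm_add_le (x - 1) 1
    rwa [sub_add_cancel, norm_one] at this
  refine (h1.trans (add_le_add_left ?_ 1)).trans (Real.add_one_le_exp _)
  rw [le_div_iff₀ hn', mul_comm]
  exact h

/-- If `n (x_n - 1) → y` then `x_n ^ n → exp y`. -/
theorem tendsto_pow_exp_of_tendsto_smul_sub_one [NormOneClass 𝔸] [NormedAlgebra ℝ 𝔸]
    [CompleteSpace 𝔸] {x : ℕ → 𝔸} {y : 𝔸}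
    (h : Tendsto (fun n : ℕ => (n : ℝ) • (x n - 1)) atTop (𝓝 y)) :
    Tendsto (fun n => x n ^ n) atTop (𝓝 (NormedSpace.exp y)) := by
  have : NormedAlgebra ℚ 𝔸 := NormedAlgebra.restrictScalars ℚ ℝ 𝔸
  -- Comparison sequence whose `n`-th power is exactly `exp y`; it agrees with `x n` up to `o(1/n)`,
  -- so the `n`-th powers differ by `o(1)`.
  set z : ℕ → 𝔸 := fun n => NormedSpace.exp ((n : ℝ)⁻¹ • y) with hz
  have hzpow : ∀ n : ℕ, 0 < n → z n ^ n = NormedSpace.exp y := by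
    intro n hn
    have hn' : (n : ℝ) ≠ 0 := by exact_mod_cast hn.ne'
    rw [hz, ← NormedSpace.exp_nsmul, ← Nat.cast_smul_eq_nsmul ℝ, smul_smul, mul_inv_cancel₀ hn',
      one_smul]
  have hzlim : Tendsto (fun n : ℕ => (n : ℝ) • (z n - 1)) atTop (𝓝 y) := by
    have hd : HasDerivAt (fun t : ℝ => NormedSpace.exp (t • y)) y 0 := by
      simpa using hasDerivAt_exp_smul_const (𝕂 := ℝ) y (0 : ℝ)
    have h1 := hd.tendsto_slope.comp
      ((tendsto_inv_atTop_nhdsGT_zero.mono_right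
        (nhdsWithin_mono 0 fun t (ht : 0 < t) => ht.ne')).comp
          (tendsto_natCast_atTop_atTop (R := ℝ)))
    refine h1.congr fun n => ?_
    simp [slope, hz]
  obtain ⟨C₁, hC₁⟩ := (h.norm.isBoundedUnder_le).eventually_le
  obtain ⟨C₂, hC₂⟩ := (hzlim.norm.isBoundedUnder_le).eventually_le
  set C := max (max C₁ C₂) 0
  have hdiff : Tendsto (fun n : ℕ => Real.exp C * ‖(n : ℝ) • (x n - z n)‖) atTop (𝓝 0) := by
    have h2 := (h.sub hzlim).norm.const_mul (Real.exp C)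
    simp only [sub_self, norm_zero, mul_zero, ← smul_sub, sub_sub_sub_cancel_right] at h2
    exact h2
  rw [tendsto_iff_norm_sub_tendsto_zero]
  refine squeeze_zero' (Eventually.of_forall fun _ => norm_nonneg _) ?_ hdiff
  filter_upwards [hC₁, hC₂, eventually_gt_atTop 0] with n h1 h2 hn
  have hn' : (n : ℝ) ≠ 0 := by exact_mod_cast hn.ne'
  rw [← hzpow n hn]
  have hM : 1 ≤ Real.exp (C / n) :=
    Real.one_le_exp (div_nonneg (le_max_right _ _) (Nat.cast_nonneg n))
  refine (norm_pow_sub_pow_le hM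
    (norm_le_exp_of_norm_smul_sub_one_le hn (h1.trans ((le_max_left _ _).trans (le_max_left _ _))))
    (norm_le_exp_of_norm_smul_sub_one_le hn (h2.trans ((le_max_right _ _).trans (le_max_left _ _))))
    n).trans_eq ?_
  rw [← Real.exp_nat_mul, mul_div_cancel₀ _ hn', norm_smul, Real.norm_natCast]
  ring

end PowerLimit

/-! ### Matrix powers as sums over words -/

section MatrixPower

variable {ι : Type*} [Fintype ι] [DecidableEq ι]

attribute [local instance] Matrix.linftyOpNormedRing Matrix.linftyOpNormedAlgebra

/-- Entrywise convergence is enough since the index set is finite. The limit is an entry of the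
matrix exponential, recorded as a series so that its coefficients can be compared with covering
weights. -/
theorem matrix_tendsto_pow_hasSum {K : ℕ → Matrix ι ι ℂ} {M : Matrix ι ι ℂ}
    (h : ∀ x y, Tendsto (fun n : ℕ => (n : ℂ) * (K n x y - (1 : Matrix ι ι ℂ) x y)) atTop
      (𝓝 (M x y))) (a b : ι) :
    ∃ z, Tendsto (fun n => (K n ^ n) a b) atTop (𝓝 z) ∧
      HasSum (fun N : ℕ => ((N.factorial : ℂ))⁻¹ * (M ^ N) a b) z := by
  have : Nonempty ι := ⟨a⟩
  have : NormedAlgebra ℚ (Matrix ι ι ℂ) := NormedAlgebra.restrictScalars ℚ ℝ _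
  have h1 : Tendsto (fun n : ℕ => (n : ℝ) • (K n - 1)) atTop (𝓝 M) := by
    refine tendsto_pi_nhds.2 fun x => tendsto_pi_nhds.2 fun y => ?_
    simpa using h x y
  have h2 := tendsto_pow_exp_of_tendsto_smul_sub_one h1
  refine ⟨NormedSpace.exp M a b, tendsto_pi_nhds.1 (tendsto_pi_nhds.1 h2 a) b, ?_⟩
  have h3 := NormedSpace.exp_series_hasSum_exp' (𝕂 := ℂ) M
  have h4 : HasSum (fun N : ℕ => ((N.factorial : ℂ)⁻¹ • M ^ N) a b) (NormedSpace.exp M a b) :=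
    Pi.hasSum.1 (Pi.hasSum.1 h3 a) b
  simpa using h4

/-- The path starting at `a` and then following the word `x`. -/
def wordPath {α : Type*} (a : α) {n : ℕ} (x : Fin n → α) : ℕ → α
  | 0 => a
  | i + 1 => if h : i < n then x ⟨i, h⟩ else a

theorem wordPath_snoc_of_le {α : Type*} (a : α) {n : ℕ} (x : Fin n → α) (y : α) {i : ℕ}
    (hi : i ≤ n) : wordPath a (Fin.snoc x y : Fin (n + 1) → α) i = wordPath a x i := by
  cases i with
  | zero => rfl
  | succ i =>
    have h : i < n := hi
    simp [wordPath, h, Nat.lt_succ_of_lt h, Fin.snoc]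

theorem wordPath_snoc_last {α : Type*} (a : α) {n : ℕ} (x : Fin n → α) (y : α) :
    wordPath a (Fin.snoc x y : Fin (n + 1) → α) (n + 1) = y := by
  simp [wordPath, Fin.snoc]

theorem sum_words_eq_pow (K : Matrix ι ι ℂ) (a b : ι) (n : ℕ) :
    ∑ x : Fin n → ι, (if wordPath a x n = b then
      ∏ i ∈ Finset.range n, K (wordPath a x i) (wordPath a x (i + 1)) else 0) = (K ^ n) a b := by
  induction n generalizing b with
  | zero => simp [wordPath, Matrix.one_apply]
  | succ n ih =>
    rw [← (Fin.snocEquiv fun _ => ι).sum_comp, Fintype.sum_prod_type]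
    have h1 : ∀ (y : ι) (x : Fin n → ι),
        (if wordPath a (Fin.snoc x y : Fin (n + 1) → ι) (n + 1) = b then
          ∏ i ∈ Finset.range (n + 1), K (wordPath a (Fin.snoc x y : Fin (n + 1) → ι) i)
            (wordPath a (Fin.snoc x y : Fin (n + 1) → ι) (i + 1)) else 0) =
        if y = b then (∏ i ∈ Finset.range n, K (wordPath a x i) (wordPath a x (i + 1))) *
          K (wordPath a x n) y else 0 := by
      intro y x
      rw [wordPath_snoc_last, Finset.prod_range_succ, wordPath_snoc_last,
        wordPath_snoc_of_le a x y le_rfl]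
      congr 2
      refine Finset.prod_congr rfl fun i hi => ?_
      have := Finset.mem_range.1 hi
      rw [wordPath_snoc_of_le a x y this.le, wordPath_snoc_of_le a x y this]
    refine Eq.trans (Finset.sum_congr rfl fun y _ => Finset.sum_congr rfl fun x _ => h1 y x) ?_
    rw [Finset.sum_comm]
    simp only [Finset.sum_ite_eq', Finset.mem_univ, if_true]
    rw [pow_succ, Matrix.mul_apply]
    simp only [← ih, Finset.sum_mul, ite_mul, zero_mul]
    rw [Finset.sum_comm]
    refine Finset.sum_congr rfl fun x _ => ?_
    simp

end MatrixPower

/-! ### Right-continuous paths sampled on a grid -/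

section Paths

variable {Λ : Type*}

theorem tendsto_div_natCast (T : ℝ≥0) : Tendsto (fun n : ℕ => T / (n : ℝ≥0)) atTop (𝓝 0) := by
  rw [← NNReal.tendsto_coe]
  simpa using tendsto_const_div_atTop_nhds_zero_nat (T : ℝ)

/-- The first grid point `i T / n` which is at least `s`. -/
def gridCeil (T : ℝ≥0) (n : ℕ) (s : ℝ≥0) : ℝ≥0 := (⌈s * n / T⌉₊ : ℝ≥0) * (T / n)

theorem le_gridCeil {T : ℝ≥0} (hT : 0 < T) {n : ℕ} (hn : 0 < n) (s : ℝ≥0) :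
    s ≤ gridCeil T n s := by
  have hn' : (0 : ℝ≥0) < n := by exact_mod_cast hn
  calc s = (s * n / T) * (T / n) := by field_simp
    _ ≤ gridCeil T n s := mul_le_mul_left (Nat.le_ceil _) _

theorem gridCeil_le {T : ℝ≥0} (hT : 0 < T) {n : ℕ} (hn : 0 < n) (s : ℝ≥0) :
    gridCeil T n s ≤ s + T / n := by
  have hn' : (0 : ℝ≥0) < n := by exact_mod_cast hn
  calc gridCeil T n s ≤ (s * n / T + 1) * (T / n) :=
        mul_le_mul_left (Nat.ceil_lt_add_one zero_le).le _
    _ = s + T / n := by field_simp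

/-- Rounding up makes the sampling times approach `s` from the right, so that right continuity alone
controls the sampled path. -/
theorem tendsto_gridCeil {T : ℝ≥0} (hT : 0 < T) (s : ℝ≥0) :
    Tendsto (fun n => gridCeil T n s) atTop (𝓝[≥] s) := by
  refine tendsto_nhdsWithin_iff.2 ⟨?_, ?_⟩
  · have h1 : Tendsto (fun n : ℕ => s + T / (n : ℝ≥0)) atTop (𝓝 s) := by
      simpa using (tendsto_div_natCast T).const_add s
    refine tendsto_of_tendsto_of_tendsto_of_le_of_le' tendsto_const_nhds h1 ?_ ?_
    · filter_upwards [eventually_gt_atTop 0] with n hn using le_gridCeil hT hn s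
    · filter_upwards [eventually_gt_atTop 0] with n hn using gridCeil_le hT hn s
  · filter_upwards [eventually_gt_atTop 0] with n hn using le_gridCeil hT hn s

theorem ceil_grid_le {T : ℝ≥0} (n : ℕ) {s : ℝ≥0} (hs : s ≤ T) :
    ⌈s * n / T⌉₊ ≤ n := by
  refine Nat.ceil_le.2 (div_le_of_le_mul₀ zero_le zero_le ?_)
  rw [mul_comm]
  exact mul_le_mul_right hs _

theorem ceil_grid_eq {T : ℝ≥0} (hT : 0 < T) {n : ℕ} (hn : 0 < n) (i : ℕ) {s : ℝ≥0}
    (h1 : i * (T / n) < s) (h2 : s ≤ (i + 1 : ℕ) * (T / n)) : ⌈s * n / T⌉₊ = i + 1 := by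
  have hn' : (0 : ℝ≥0) < n := by exact_mod_cast hn
  refine (Nat.ceil_eq_iff (Nat.succ_ne_zero i)).2 ⟨?_, ?_⟩
  · rw [Nat.succ_sub_one, lt_div_iff₀ hT]
    calc (i : ℝ≥0) * T = i * (T / n) * n := by field_simp
      _ < s * n := mul_lt_mul_of_pos_right h1 hn'
  · rw [div_le_iff₀ hT]
    calc s * n ≤ (i + 1 : ℕ) * (T / n) * n := mul_le_mul_left h2 _
      _ = (i + 1 : ℕ) * T := by field_simp

theorem measurable_comp_gridCeil (T : ℝ≥0) (n : ℕ) (f : ℝ≥0 → ℝ) :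
    Measurable fun s : ℝ => f (gridCeil T n s.toNNReal) := by
  have h : Measurable fun s : ℝ => ⌈s.toNNReal * n / T⌉₊ :=
    Nat.measurable_ceil.comp (by fun_prop)
  exact (measurable_from_nat (f := fun k : ℕ => f ((k : ℝ≥0) * (T / n)))).comp h

/-- Riemann sums over the grid are integrals of the path sampled at the grid. -/
theorem integral_comp_gridCeil {T : ℝ≥0} (hT : 0 < T) {n : ℕ} (hn : 0 < n) {f : ℝ≥0 → ℝ} {C : ℝ}
    (hf : ∀ s, ‖f s‖ ≤ C) :
    ∫ s in (0 : ℝ)..T, f (gridCeil T n s.toNNReal) =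
      ∑ i ∈ Finset.range n, (T / n : ℝ) * f ((i + 1 : ℕ) * (T / n)) := by
  have hn' : (0 : ℝ) < n := by exact_mod_cast hn
  have hT' : (0 : ℝ) < T := by exact_mod_cast hT
  have hint : ∀ u v : ℝ, IntervalIntegrable (fun s : ℝ => f (gridCeil T n s.toNNReal)) volume u v :=
    fun u v => (intervalIntegrable_const (c := C)).mono_fun'
      (measurable_comp_gridCeil T n f).aestronglyMeasurable (ae_of_all _ fun s => hf _)
  have h := intervalIntegral.sum_integral_adjacent_intervals (n := n)
    (a := fun i : ℕ => (i : ℝ) * (T / n)) (fun i _ => hint _ _)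
  have h0 : ((0 : ℕ) : ℝ) * (T / n) = 0 := by simp
  have h1 : (n : ℝ) * (T / n) = T := by field_simp
  rw [h0, h1] at h
  rw [← h]
  refine Finset.sum_congr rfl fun i _ => ?_
  have hle : (i : ℝ) * (T / n) ≤ ((i + 1 : ℕ) : ℝ) * (T / n) := by
    push_cast
    gcongr
    linarith
  rw [intervalIntegral.integral_congr_ae (g := fun _ => f ((i + 1 : ℕ) * (T / n)))]
  · rw [intervalIntegral.integral_const, smul_eq_mul]
    congr 1
    push_cast
    ring
  · refine ae_of_all _ fun s hs => ?_
    rw [Set.uIoc_of_le hle] at hs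
    have hs0 : (0 : ℝ) ≤ s := (by positivity : (0 : ℝ) ≤ (i : ℝ) * (T / n)).trans hs.1.le
    rw [gridCeil, ceil_grid_eq hT hn i]
    · rw [← NNReal.coe_lt_coe, Real.coe_toNNReal s hs0]
      exact_mod_cast hs.1
    · rw [← NNReal.coe_le_coe, Real.coe_toNNReal s hs0]
      exact_mod_cast hs.2

theorem tendsto_riemann_sum [DecidableEq Λ] {T : ℝ≥0} (hT : 0 < T) {ξ : ℝ≥0 → Λ}
    (hξ : ∀ t, ∀ᶠ s in 𝓝[≥] t, ξ s = ξ t) (z : Λ) :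
    Tendsto (fun n : ℕ => ∑ i ∈ Finset.range n,
      (T / n : ℝ) * (if ξ ((i + 1 : ℕ) * (T / n)) = z then 1 else 0)) atTop
      (𝓝 (∫ s in (0 : ℝ)..T, if ξ s.toNNReal = z then 1 else 0)) := by
  set f : ℝ≥0 → ℝ := fun s => if ξ s = z then 1 else 0 with hf
  have hb : ∀ s, ‖f s‖ ≤ 1 := by
    intro s
    simp only [hf]
    split_ifs <;> simp
  have h := intervalIntegral.tendsto_integral_filter_of_dominated_convergence
    (μ := volume) (a := (0 : ℝ)) (b := T) (l := atTop)
    (F := fun (n : ℕ) (s : ℝ) => f (gridCeil T n s.toNNReal)) (f := fun s => f s.toNNReal)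
    (fun _ => 1) (Eventually.of_forall fun n =>
      (measurable_comp_gridCeil T n f).aestronglyMeasurable)
    (Eventually.of_forall fun n => ae_of_all _ fun s _ => hb _) intervalIntegrable_const
    (ae_of_all _ fun s _ => tendsto_const_nhds.congr' ?_)
  · refine h.congr' ?_
    filter_upwards [eventually_gt_atTop 0] with n hn
    rw [integral_comp_gridCeil hT hn hb]
  · filter_upwards [(tendsto_gridCeil hT s.toNNReal).eventually (hξ s.toNNReal)] with n hn
    simp only [hf, hn]

/-- By right continuity the path keeps the value `ξ s` at the first grid point after `s` once the
mesh is fine, so a visit outside `S` is seen on the grid. -/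
theorem eventually_exists_grid_notMem {T : ℝ≥0} (hT : 0 < T) {ξ : ℝ≥0 → Λ}
    (hξ : ∀ t, ∀ᶠ s in 𝓝[≥] t, ξ s = ξ t) {S : Set Λ} {s : ℝ≥0} (hs : s ≤ T) (hsS : ξ s ∉ S) :
    ∀ᶠ n : ℕ in atTop, ∃ i ≤ n, ξ (i * (T / n)) ∉ S := by
  filter_upwards [(tendsto_gridCeil hT s).eventually (hξ s)] with n hn
  refine ⟨⌈s * n / T⌉₊, ceil_grid_le n hs, ?_⟩
  rw [gridCeil] at hn
  rwa [hn]

end Paths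

/-! ### Characteristic function of the chain confined to a finite set -/

section Chain

variable {Λ : Type*} {Ω : Type*} {ι : Type*}

/-- The event that the chain follows the word `x` on the grid of mesh `T / n`. -/
def gridEvent (X : ℝ≥0 → Ω → Λ) (T : ℝ≥0) (e : ι → Λ) (a : ι) {n : ℕ} (x : Fin n → ι) : Set Ω :=
  {ω | ∀ i ≤ n, X (i * (T / n)) ω = e (wordPath a x i)}

theorem measurableSet_gridEvent [MeasurableSpace Ω] {X : ℝ≥0 → Ω → Λ}
    (hX : ∀ t x, MeasurableSet {ω | X t ω = x})
    (T : ℝ≥0) (e : ι → Λ) (a : ι) {n : ℕ} (x : Fin n → ι) :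
    MeasurableSet (gridEvent X T e a x) := by
  have : gridEvent X T e a x = ⋂ i ∈ Finset.range (n + 1),
      {ω | X (i * (T / n)) ω = e (wordPath a x i)} := by
    ext ω
    simp [gridEvent]
  rw [this]
  exact Finset.measurableSet_biInter _ fun i _ => hX _ _

/-- The one-step matrix of the grid approximation. -/
def gridMatrix (p : ℝ≥0 → Matrix Λ Λ ℝ) (e : ι → Λ) (v : ι → ℝ) (h : ℝ≥0) : Matrix ι ι ℂ :=
  Matrix.of fun x y => (p h (e x) (e y) : ℂ) * Complex.exp (Complex.I * h * v y)

/-- Only the entries between states in the image of `e` enter, so the entrywise derivative of the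
transition function suffices and no regularity of the full chain is involved. -/
theorem tendsto_gridMatrix [DecidableEq Λ] [DecidableEq ι] {p : ℝ≥0 → Matrix Λ Λ ℝ}
    {A : Matrix Λ Λ ℝ} (hp : HasGenerator p A)
    {T : ℝ≥0} (hT : 0 < T) {e : ι → Λ} (he : Function.Injective e) (v : ι → ℝ) (x y : ι) :
    Tendsto (fun n : ℕ => (n : ℂ) * (gridMatrix p e v (T / n) x y - (1 : Matrix ι ι ℂ) x y)) atTop
      (𝓝 (((T : ℂ) • ((A.submatrix e e).map Complex.ofReal +
        Matrix.diagonal fun y => Complex.I * v y)) x y)) := by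
  have hh : Tendsto (fun n : ℕ => T / (n : ℝ≥0)) atTop (𝓝[>] 0) := by
    refine tendsto_nhdsWithin_iff.2 ⟨tendsto_div_natCast T, ?_⟩
    filter_upwards [eventually_gt_atTop 0] with n hn
    have : (0 : ℝ≥0) < n := by exact_mod_cast hn
    exact div_pos hT this
  have h1 : Tendsto (fun n : ℕ => (((p (T / n) (e x) (e y) - (1 : Matrix Λ Λ ℝ) (e x) (e y)) /
      ((T / n : ℝ≥0) : ℝ) : ℝ) : ℂ)) atTop (𝓝 (A (e x) (e y) : ℂ)) :=
    (Complex.continuous_ofReal.tendsto _).comp ((hp (e x) (e y)).comp hh)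
  have hd : HasDerivAt (fun t : ℝ => Complex.exp (Complex.I * t * v y)) (Complex.I * v y) 0 := by
    have h0 : HasDerivAt (fun t : ℝ => Complex.I * (t : ℂ) * v y) (Complex.I * v y) 0 := by
      simpa using ((Complex.ofRealCLM.hasDerivAt (x := (0 : ℝ))).const_mul Complex.I).mul_const
        (v y : ℂ)
    simpa using h0.cexp
  have hreal : Tendsto (fun n : ℕ => ((T / (n : ℝ≥0) : ℝ≥0) : ℝ)) atTop (𝓝[≠] 0) := by
    refine tendsto_nhdsWithin_iff.2 ⟨?_, ?_⟩
    · exact (NNReal.continuous_coe.tendsto 0).comp (tendsto_div_natCast T)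
    · filter_upwards [eventually_gt_atTop 0] with n hn
      have : (0 : ℝ) < n := by exact_mod_cast hn
      have hT' : (0 : ℝ) < T := by exact_mod_cast hT
      push_cast
      exact (div_pos hT' this).ne'
  have h2 := hd.tendsto_slope.comp hreal
  have h3 : Tendsto (fun n : ℕ => Complex.exp (Complex.I * ((T / (n : ℝ≥0) : ℝ≥0) : ℝ) * v y))
      atTop (𝓝 1) := by
    have := hd.continuousAt.tendsto.comp (hreal.mono_right nhdsWithin_le_nhds)
    simpa [Function.comp_def] using this
  -- Product rule with `h = T / n`: `n (p e^{ihv} - δ)` equals `T` times `((p - δ) / h) e^{ihv} + δ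
  -- (e^{ihv} - 1) / h`.
  have h4 := ((h1.mul h3).add (h2.const_mul ((1 : Matrix ι ι ℂ) x y))).const_mul (T : ℂ)
  have hlim : (T : ℂ) * ((A (e x) (e y) : ℂ) * 1 + (1 : Matrix ι ι ℂ) x y * (Complex.I * v y)) =
      ((T : ℂ) • ((A.submatrix e e).map Complex.ofReal +
        Matrix.diagonal fun y => Complex.I * v y)) x y := by
    rcases eq_or_ne x y with rfl | hxy
    · simp
    · simp [hxy]
  rw [← hlim]
  refine h4.congr' ?_
  filter_upwards [eventually_gt_atTop 0] with n hn
  have hn' : (n : ℂ) ≠ 0 := by exact_mod_cast hn.ne'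
  have hT' : ((T : ℝ) : ℂ) ≠ 0 := by exact_mod_cast hT.ne'
  have hone : (((1 : Matrix Λ Λ ℝ) (e x) (e y) : ℝ) : ℂ) = (1 : Matrix ι ι ℂ) x y := by
    simp only [Matrix.one_apply, he.eq_iff]
    split_ifs <;> simp
  simp only [Function.comp_apply, slope_def_module, gridMatrix, Matrix.of_apply,
    Complex.ofReal_div, Complex.ofReal_sub, hone, Complex.real_smul, Complex.ofReal_inv,
    Complex.ofReal_zero, mul_zero, zero_mul, Complex.exp_zero, sub_zero, NNReal.coe_div,
    NNReal.coe_natCast, Complex.ofReal_natCast]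
  field_simp
  ring

variable [Fintype ι]

theorem norm_exp_sum_mul_I (t v : ι → ℝ) :
    ‖Complex.exp (∑ y, (t y : ℂ) * (Complex.I * v y))‖ = 1 := by
  have : ∑ y, (t y : ℂ) * (Complex.I * v y) = ((∑ y, t y * v y : ℝ) : ℂ) * Complex.I := by
    push_cast
    rw [Finset.sum_mul]
    refine Finset.sum_congr rfl fun y _ => ?_
    ring
  rw [this, Complex.norm_exp_ofReal_mul_I]

variable [DecidableEq ι]

/-- The grid approximation of `exp(i ∑ v_y ℓ_T(y))` on the event that the chain stays in the image
of `e` and ends in `e b`. -/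
def gridFunctional (X : ℝ≥0 → Ω → Λ) (T : ℝ≥0) (e : ι → Λ) (v : ι → ℝ) (a b : ι) (n : ℕ) (ω : Ω) :
    ℂ :=
  ∑ x : Fin n → ι, (gridEvent X T e a x).indicator (fun _ => if wordPath a x n = b then
    ∏ i ∈ Finset.range n, Complex.exp (Complex.I * (T / n) * v (wordPath a x (i + 1))) else 0) ω

theorem gridFunctional_eq_zero {X : ℝ≥0 → Ω → Λ} {T : ℝ≥0} {e : ι → Λ} (v : ι → ℝ) {a b : ι}
    {n : ℕ} (hn : 0 < n) {ω : Ω}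
    (h : ¬ ((∀ i ≤ n, X (i * (T / n)) ω ∈ Set.range e) ∧ X T ω = e b)) :
    gridFunctional X T e v a b n ω = 0 := by
  have hnT : (n : ℝ≥0) * (T / n) = T := by
    have : (n : ℝ≥0) ≠ 0 := by exact_mod_cast hn.ne'
    field_simp
  refine Finset.sum_eq_zero fun x _ => ?_
  by_cases hx : ω ∈ gridEvent X T e a x
  · rw [Set.indicator_of_mem hx, if_neg]
    intro hlast
    refine h ⟨fun i hi => ⟨_, (hx i hi).symm⟩, ?_⟩
    rw [← hlast, ← hx n le_rfl, hnT]
  · exact Set.indicator_of_notMem hx _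

/-- Injectivity of `e` leaves exactly one word matching the sampled path. The product of its phases
is the exponential of the Riemann sums of the local times. -/
theorem gridFunctional_eq [DecidableEq Λ] {X : ℝ≥0 → Ω → Λ} {T : ℝ≥0} {e : ι → Λ}
    (he : Function.Injective e) (v : ι → ℝ) {a : ι} (b : ι) {n : ℕ} (hn : 0 < n) {ω : Ω}
    (h0 : X 0 ω = e a) (h : ∀ i ≤ n, X (i * (T / n)) ω ∈ Set.range e) (hb : X T ω = e b) :
    gridFunctional X T e v a b n ω = Complex.exp (∑ y, ((∑ i ∈ Finset.range n,
      (T / n : ℝ) * (if X ((i + 1 : ℕ) * (T / n)) ω = e y then 1 else 0) : ℝ) : ℂ) *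
        (Complex.I * v y)) := by
  have hnT : (n : ℝ≥0) * (T / n) = T := by
    have : (n : ℝ≥0) ≠ 0 := by exact_mod_cast hn.ne'
    field_simp
  choose w hw using fun i : Fin n => h (i + 1) i.2
  have hpath : ∀ i ≤ n, X (i * (T / n)) ω = e (wordPath a w i) := by
    intro i hi
    cases i with
    | zero => simpa [wordPath] using h0
    | succ i =>
      have hi' : i < n := hi
      have := hw ⟨i, hi'⟩
      simp only [wordPath, hi', dite_true]
      rw [this]
  have hlast : wordPath a w n = b := he (by rw [← hpath n le_rfl, hnT, hb])
  rw [gridFunctional, Finset.sum_eq_single w]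
  · rw [Set.indicator_of_mem (by exact hpath), if_pos hlast, ← Complex.exp_sum]
    congr 1
    simp only [Complex.ofReal_sum, Finset.sum_mul]
    rw [Finset.sum_comm]
    refine Finset.sum_congr rfl fun i hi => ?_
    have hi := Finset.mem_range.1 hi
    rw [Finset.sum_eq_single (wordPath a w (i + 1))]
    · rw [if_pos (hpath (i + 1) hi)]
      push_cast
      ring
    · intro y _ hy
      rw [if_neg]
      · simp
      · rw [hpath (i + 1) hi]
        exact fun h => hy (he h).symm
    · simp
  · intro x _ hx
    refine Set.indicator_of_notMem (fun hmem => hx (funext fun i => he ?_)) _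
    have h1 := hmem (i + 1) i.2
    have h2 := hpath (i + 1) i.2
    rw [h1] at h2
    simpa [wordPath] using h2
  · simp

/-- The functional `exp(i ∑ v_y ℓ_T(y))` on the event that the chain ends in `e b` and the range
satisfies `p`. -/
def rangeFunctional [DecidableEq Λ] (X : ℝ≥0 → Ω → Λ) (T : ℝ≥0) (e : ι → Λ) (v : ι → ℝ) (b : Λ)
    (p : Set Λ → Prop) : Ω → ℂ :=
  Set.indicator {ω | X T ω = b ∧ p (chainRange X T ω)} fun ω =>
    Complex.exp (∑ y, (localTime X T (e y) ω : ℂ) * (Complex.I * v y))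

/-- If the path stays in the image of `e` and ends correctly, the Riemann sums converge to the local
times. If it leaves the image, fine grids detect this and the functional is eventually zero. -/
theorem tendsto_gridFunctional [DecidableEq Λ] {X : ℝ≥0 → Ω → Λ} {T : ℝ≥0} (hT : 0 < T) {e : ι → Λ}
    (he : Function.Injective e) (v : ι → ℝ) {a : ι} (b : ι) {ω : Ω} (h0 : X 0 ω = e a)
    (hω : ∀ t, ∀ᶠ s in 𝓝[≥] t, X s ω = X t ω) :
    Tendsto (fun n => gridFunctional X T e v a b n ω) atTop
      (𝓝 (rangeFunctional X T e v (e b) (· ⊆ Set.range e) ω)) := by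
  by_cases h : X T ω = e b ∧ chainRange X T ω ⊆ Set.range e
  · rw [rangeFunctional, Set.indicator_of_mem (by exact h)]
    have hlim : Tendsto (fun n : ℕ => Complex.exp (∑ y, ((∑ i ∈ Finset.range n,
        (T / n : ℝ) * (if X ((i + 1 : ℕ) * (T / n)) ω = e y then 1 else 0) : ℝ) : ℂ) *
        (Complex.I * v y))) atTop
        (𝓝 (Complex.exp (∑ y, (localTime X T (e y) ω : ℂ) * (Complex.I * v y)))) := by
      refine (Complex.continuous_exp.tendsto _).comp (tendsto_finsetSum _ fun y _ => ?_)
      exact ((Complex.continuous_ofReal.tendsto _).comp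
        (tendsto_riemann_sum hT (ξ := fun s => X s ω) hω (e y))).mul_const _
    refine hlim.congr' ?_
    filter_upwards [eventually_gt_atTop 0] with n hn
    refine (gridFunctional_eq he v b hn h0 (fun i hi => h.2 ⟨i * (T / n), ⟨zero_le, ?_⟩, rfl⟩)
      h.1).symm
    have hn' : (0 : ℝ≥0) < n := by exact_mod_cast hn
    calc (i : ℝ≥0) * (T / n) ≤ n * (T / n) := mul_le_mul_left (by exact_mod_cast hi) _
      _ = T := by field_simp
  · rw [rangeFunctional, Set.indicator_of_notMem (by exact h)]
    refine tendsto_const_nhds.congr' ?_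
    rw [not_and_or] at h
    rcases h with h | h
    · filter_upwards [eventually_gt_atTop 0] with n hn
      exact (gridFunctional_eq_zero v hn fun h' => h h'.2).symm
    · obtain ⟨_, ⟨s, hs, rfl⟩, hsS⟩ := Set.not_subset.1 h
      filter_upwards [eventually_gt_atTop 0,
        eventually_exists_grid_notMem hT (ξ := fun s => X s ω) hω hs.2 hsS] with n hn hex
      obtain ⟨i, hi, hiS⟩ := hex
      exact (gridFunctional_eq_zero v hn fun h' => hiS (h'.1 i hi)).symm

theorem norm_gridFunctional_le [DecidableEq Λ] {X : ℝ≥0 → Ω → Λ} {T : ℝ≥0} {e : ι → Λ}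
    (he : Function.Injective e) (v : ι → ℝ) {a : ι} (b : ι) {n : ℕ} (hn : 0 < n) {ω : Ω}
    (h0 : X 0 ω = e a) : ‖gridFunctional X T e v a b n ω‖ ≤ 1 := by
  by_cases h : (∀ i ≤ n, X (i * (T / n)) ω ∈ Set.range e) ∧ X T ω = e b
  · rw [gridFunctional_eq he v b hn h0 h.1 h.2, norm_exp_sum_mul_I]
  · rw [gridFunctional_eq_zero v hn h]
    simp

variable [MeasurableSpace Ω]

theorem measurable_gridFunctional {X : ℝ≥0 → Ω → Λ} (hX : ∀ t x, MeasurableSet {ω | X t ω = x})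
    (T : ℝ≥0) (e : ι → Λ) (v : ι → ℝ) (a b : ι) (n : ℕ) :
    Measurable (gridFunctional X T e v a b n) :=
  Finset.measurable_fun_sum _ fun x _ =>
    measurable_const.indicator (measurableSet_gridEvent hX T e a x)

/-- The finite-dimensional distributions give each word the product of its one-step probabilities;
attaching the phases and summing over words is matrix multiplication. -/
theorem integral_gridFunctional {P : Measure Ω} [IsProbabilityMeasure P] {X : ℝ≥0 → Ω → Λ}
    (hX : ∀ t x, MeasurableSet {ω | X t ω = x}) {p : ℝ≥0 → Matrix Λ Λ ℝ} (e : ι → Λ) (a : ι)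
    (hp : ∀ (n : ℕ) (t : ℕ → ℝ≥0) (x : ℕ → Λ), Monotone t → t 0 = 0 → x 0 = e a →
      P.real {ω | ∀ i ≤ n, X (t i) ω = x i} =
        ∏ i ∈ Finset.range n, p (t (i + 1) - t i) (x i) (x (i + 1)))
    (T : ℝ≥0) (v : ι → ℝ) (b : ι) (n : ℕ) :
    ∫ ω, gridFunctional X T e v a b n ω ∂P = (gridMatrix p e v (T / n) ^ n) a b := by
  rw [← sum_words_eq_pow]
  simp only [gridFunctional]
  rw [integral_finsetSum]
  · refine Finset.sum_congr rfl fun x _ => ?_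
    have hprob : P.real (gridEvent X T e a x) = ∏ i ∈ Finset.range n,
        p (T / n) (e (wordPath a x i)) (e (wordPath a x (i + 1))) := by
      have := hp n (fun i => i * (T / n)) (fun i => e (wordPath a x i))
        (fun i j hij => mul_le_mul_left (by exact_mod_cast hij) _) (by simp) rfl
      rw [gridEvent, this]
      refine Finset.prod_congr rfl fun i _ => ?_
      congr 1
      push_cast
      rw [add_mul, one_mul, add_tsub_cancel_left]
    rw [integral_indicator (measurableSet_gridEvent hX T e a x), setIntegral_const, hprob]
    split_ifs
    · simp [gridMatrix, Finset.prod_mul_distrib]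
    · simp
  · intro x _
    exact (integrable_const _).indicator (measurableSet_gridEvent hX T e a x)

variable [DecidableEq Λ]

theorem IsMarkovChain.ae_start {P : Measure Ω} [IsProbabilityMeasure P] {A : Matrix Λ Λ ℝ} {a : Λ}
    {X : ℝ≥0 → Ω → Λ} (hX : IsMarkovChain P A a X) : ∀ᵐ ω ∂P, X 0 ω = a := by
  obtain ⟨p, -, -, hfdd⟩ := hX.markov
  have h := hfdd 0 (fun _ => 0) (fun _ => a) monotone_const rfl rfl
  simp only [nonpos_iff_eq_zero, forall_eq, Finset.range_zero, Finset.prod_empty] at h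
  rw [ae_iff, ← Set.compl_ofPred, prob_compl_eq_zero_iff (hX.measurable 0 a)]
  rwa [measureReal_def, ENNReal.toReal_eq_one_iff] at h

/-- The characteristic function of the local times of the chain killed outside of the image of `e`,
as a power series in the time. -/
theorem IsMarkovChain.integrable_and_hasSum_killed {P : Measure Ω} [IsProbabilityMeasure P]
    {A : Matrix Λ Λ ℝ} {e : ι → Λ} (he : Function.Injective e) {a : ι} {X : ℝ≥0 → Ω → Λ}
    (hX : IsMarkovChain P A (e a) X) {T : ℝ≥0} (hT : 0 < T) (v : ι → ℝ) (b : ι) :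
    Integrable (rangeFunctional X T e v (e b) (· ⊆ Set.range e)) P ∧
    HasSum (fun N : ℕ => (T : ℂ) ^ N / N.factorial *
      (((A.submatrix e e).map Complex.ofReal + Matrix.diagonal fun y => Complex.I * v y) ^ N) a b)
      (∫ ω, rangeFunctional X T e v (e b) (· ⊆ Set.range e) ω ∂P) := by
  obtain ⟨p, -, hgen, hfdd⟩ := hX.markov
  -- The index `n + 1` avoids the degenerate mesh `T / 0`, for which the bound and the evaluation of
  -- the functional are not available.
  have hlim : ∀ᵐ ω ∂P, Tendsto (fun n => gridFunctional X T e v a b (n + 1) ω) atTop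
      (𝓝 (rangeFunctional X T e v (e b) (· ⊆ Set.range e) ω)) := by
    filter_upwards [hX.ae_start, hX.right_continuous] with ω h0 hω
    exact (tendsto_gridFunctional hT he v b h0 hω).comp (tendsto_add_atTop_nat 1)
  have hmeas : ∀ n, AEStronglyMeasurable (gridFunctional X T e v a b (n + 1)) P := fun n =>
    (measurable_gridFunctional hX.measurable T e v a b (n + 1)).aestronglyMeasurable
  have hbound : ∀ n, ∀ᵐ ω ∂P, ‖gridFunctional X T e v a b (n + 1) ω‖ ≤ 1 := by
    intro n
    filter_upwards [hX.ae_start] with ω h0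
    exact norm_gridFunctional_le he v b n.succ_pos h0
  have h1 := tendsto_integral_of_dominated_convergence (fun _ => (1 : ℝ)) hmeas
    (integrable_const 1) hbound hlim
  refine ⟨Integrable.of_bound (aestronglyMeasurable_of_tendsto_ae atTop hmeas hlim) 1 ?_, ?_⟩
  · refine ae_of_all _ fun ω => ?_
    rw [rangeFunctional]
    refine (norm_indicator_le_norm_self _ _).trans (norm_exp_sum_mul_I _ _).le
  · obtain ⟨z, hz1, hz2⟩ := matrix_tendsto_pow_hasSum (tendsto_gridMatrix hgen hT he v) a b
    simp only [integral_gridFunctional hX.measurable e a hfdd] at h1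
    have h2 := tendsto_nhds_unique h1 (hz1.comp (tendsto_add_atTop_nat 1))
    rw [h2]
    convert hz2 using 2 with N
    rw [smul_pow, Matrix.smul_apply, smul_eq_mul, div_eq_inv_mul, mul_assoc]

end Chain

/-! ### From range contained in a set to range equal to it -/

section Covering

variable {Λ : Type*} [DecidableEq Λ] {Ω : Type*} {ι : Type*} [Fintype ι]

theorem localTime_eq_zero {X : ℝ≥0 → Ω → Λ} {T : ℝ≥0} {z : Λ} {ω : Ω}
    (h : z ∉ chainRange X T ω) : localTime X T z ω = 0 := by
  refine intervalIntegral.integral_zero_ae (ae_of_all _ fun s hs => ?_)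
  rw [Set.uIoc_of_le T.coe_nonneg] at hs
  refine if_neg fun hz => h ⟨s.toNNReal, ⟨zero_le, ?_⟩, hz⟩
  exact Real.toNNReal_le_iff_le_coe.2 hs.2

/-- A path whose range lies in the image of `S` has as range the image of a unique subset. Local
times of unvisited states vanish, so summing over `S` or over all of `ι` in the exponent is the
same. -/
theorem rangeFunctional_subset_eq_sum {X : ℝ≥0 → Ω → Λ} {T : ℝ≥0} {e : ι → Λ}
    (he : Function.Injective e) (v : ι → ℝ) (S : Finset ι) (b : S) (ω : Ω) :
    rangeFunctional X T (fun x : S => e x) (fun x : S => v x) (e b)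
        (· ⊆ Set.range fun x : S => e x) ω =
      ∑ S' ∈ S.powerset, rangeFunctional X T e v (e b) (· = e '' S') ω := by
  classical
  have hrange : (Set.range fun x : S => e x) = e '' S := by
    ext z; simp
  rw [hrange]
  by_cases h : X T ω = e b ∧ chainRange X T ω ⊆ e '' S
  · set S₀ := S.filter fun x => e x ∈ chainRange X T ω with hS₀
    have hS₀r : chainRange X T ω = e '' S₀ := by
      ext z
      constructor
      · intro hz
        obtain ⟨x, hx, rfl⟩ := h.2 hz
        exact ⟨x, by simpa [hS₀] using ⟨hx, hz⟩, rfl⟩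
      · rintro ⟨x, hx, rfl⟩
        exact (Finset.mem_filter.1 hx).2
    rw [Finset.sum_eq_single_of_mem S₀ (Finset.mem_powerset.2 (Finset.filter_subset _ _))]
    · rw [rangeFunctional, Set.indicator_of_mem (by exact h), rangeFunctional,
        Set.indicator_of_mem (by exact ⟨h.1, hS₀r⟩)]
      congr 1
      rw [Finset.sum_coe_sort S fun y => (localTime X T (e y) ω : ℂ) * (Complex.I * v y)]
      refine Finset.sum_subset (Finset.subset_univ S) fun y _ hy => ?_
      rw [localTime_eq_zero, Complex.ofReal_zero, zero_mul]
      intro hmem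
      obtain ⟨x, hx, hxy⟩ := h.2 hmem
      exact hy (he hxy ▸ hx)
    · intro S' _ hne
      refine Set.indicator_of_notMem (fun hmem => hne ?_) _
      have : e '' S' = e '' S₀ := hmem.2.symm.trans hS₀r
      exact Finset.coe_injective (he.image_injective this)
  · rw [rangeFunctional, Set.indicator_of_notMem (by exact h)]
    symm
    refine Finset.sum_eq_zero fun S' hS' => Set.indicator_of_notMem (fun hmem => h ⟨hmem.1, ?_⟩) _
    have hr : chainRange X T ω = e '' S' := hmem.2
    rw [hr]
    exact Set.image_mono (Finset.coe_subset.2 (Finset.mem_powerset.1 hS'))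

variable [DecidableEq ι] [MeasurableSpace Ω]

/-- The characteristic function of the local times of the chain on the event that its range is the
image of `S`, as a power series in the time. -/
theorem IsMarkovChain.integrable_and_hasSum_covering {P : Measure Ω} [IsProbabilityMeasure P]
    {A : Matrix Λ Λ ℝ} {e : ι → Λ} (he : Function.Injective e) {a : ι} {X : ℝ≥0 → Ω → Λ}
    (hX : IsMarkovChain P A (e a) X) {T : ℝ≥0} (hT : 0 < T) (v : ι → ℝ) (b : ι) (S : Finset ι) :
    Integrable (rangeFunctional X T e v (e b) (· = e '' S)) P ∧
    HasSum (fun N : ℕ => (T : ℂ) ^ N / N.factorial *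
      coveringWeight ((A.submatrix e e).map Complex.ofReal +
        Matrix.diagonal fun y => Complex.I * v y) S N a b)
      (∫ ω, rangeFunctional X T e v (e b) (· = e '' S) ω ∂P) := by
  set B := (A.submatrix e e).map Complex.ofReal + Matrix.diagonal fun y => Complex.I * v y with hB
  induction S using Finset.strongInduction with
  | H S ih =>
  by_cases hab : a ∈ S ∧ b ∈ S
  · obtain ⟨ha, hb⟩ := hab
    have hinj : Function.Injective fun x : S => e x := he.comp Subtype.val_injective
    obtain ⟨hi, hs⟩ := hX.integrable_and_hasSum_killed (e := fun x : S => e x) (a := ⟨a, ha⟩)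
      hinj hT (fun x : S => v x) ⟨b, hb⟩
    have hsub : (A.submatrix (fun x : S => e x) fun x : S => e x).map Complex.ofReal +
        Matrix.diagonal (fun y : S => Complex.I * v y) =
          B.submatrix (fun x : S => (x : ι)) (fun x : S => (x : ι)) := by
      ext x y
      rcases eq_or_ne x y with rfl | hxy
      · simp [hB]
      · have : (x : ι) ≠ y := fun h => hxy (Subtype.ext h)
        simp [hB, hxy, this]
    rw [hsub] at hs
    have hf : rangeFunctional X T (fun x : S => e x) (fun x : S => v x) (e b)
        (· ⊆ Set.range fun x : S => e x) =
        fun ω => ∑ S' ∈ S.powerset, rangeFunctional X T e v (e b) (· = e '' S') ω :=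
      funext fun ω => rangeFunctional_subset_eq_sum he v S ⟨b, hb⟩ ω
    simp only [hf] at hi hs
    have hss : ∀ S' ∈ S.powerset.erase S, S' ⊂ S := by
      intro S' hS'
      obtain ⟨h1, h2⟩ := Finset.mem_erase.1 hS'
      exact (Finset.mem_powerset.1 h2).ssubset_of_ne h1
    have hiS : Integrable (rangeFunctional X T e v (e b) (· = e '' S)) P := by
      have h1 := hi.sub (integrable_finsetSum (S.powerset.erase S)
        fun S' hS' => (ih S' (hss S' hS')).1)
      refine h1.congr (ae_of_all _ fun ω => ?_)
      simp only [Pi.sub_apply]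
      rw [← Finset.add_sum_erase _ _ (Finset.mem_powerset_self S), add_sub_cancel_right]
    refine ⟨hiS, ?_⟩
    have hint : ∀ S' ∈ S.powerset, Integrable (rangeFunctional X T e v (e b) (· = e '' S')) P := by
      intro S' hS'
      rcases eq_or_ne S' S with rfl | hne
      · exact hiS
      · exact (ih S' (hss S' (Finset.mem_erase.2 ⟨hne, hS'⟩))).1
    rw [integral_finsetSum _ hint] at hs
    -- Inclusion-exclusion: the contributions of proper subsets, known by induction, are subtracted
    -- from the series of the chain confined to `S`. `sum_powerset_coveringWeight` says the
    -- coefficients obey the same subtraction.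
    have h2 := hs.sub (hasSum_sum fun S' hS' => (ih S' (hss S' hS')).2)
    rw [← Finset.add_sum_erase _ _ (Finset.mem_powerset_self S), add_sub_cancel_right] at h2
    have hN : ∀ N : ℕ, coveringWeight B S N a b =
        ((B.submatrix (fun x : S => (x : ι)) (fun x : S => (x : ι))) ^ N) ⟨a, ha⟩ ⟨b, hb⟩ -
          ∑ S' ∈ S.powerset.erase S, coveringWeight B S' N a b := by
      intro N
      rw [← sum_powerset_coveringWeight B S N ⟨a, ha⟩ ⟨b, hb⟩,
        ← Finset.add_sum_erase _ _ (Finset.mem_powerset_self S), add_sub_cancel_right]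
    simp only [hN, mul_sub, Finset.mul_sum]
    exact h2
  -- The range contains the starting point and the endpoint, so both sides vanish when `a` or `b` is
  -- missing from `S`.
  · have hzero : rangeFunctional X T e v (e b) (· = e '' S) =ᵐ[P] 0 := by
      filter_upwards [hX.ae_start] with ω h0
      refine Set.indicator_of_notMem (fun hmem => hab ?_) _
      have hr : chainRange X T ω = e '' S := hmem.2
      have h1 : e a ∈ e '' S := hr ▸ ⟨0, ⟨le_rfl, zero_le⟩, h0⟩
      have h2 : e b ∈ e '' S := hr ▸ ⟨T, ⟨zero_le, le_rfl⟩, hmem.1⟩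
      exact ⟨by simpa using he.mem_set_image.1 h1, by simpa using he.mem_set_image.1 h2⟩
    refine ⟨(integrable_zero _ _ _).congr hzero.symm, ?_⟩
    rw [integral_congr_ae hzero]
    simp [coveringWeight, hab]

/-- On the event that the chain visits precisely the states in the image of `e`, the
characteristic function of the local times is that of the density. -/
theorem IsMarkovChain.integral_rangeFunctional_eq {P : Measure Ω} [IsProbabilityMeasure P]
    {A : Matrix Λ Λ ℝ} {e : ι → Λ} (he : Function.Injective e) {a : ι} {X : ℝ≥0 → Ω → Λ}
    (hX : IsMarkovChain P A (e a) X) {T : ℝ≥0} (hT : 0 < T) (v : ι → ℝ) (b : ι) :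
    ∫ ω, rangeFunctional X T e v (e b) (· = Set.range e) ω ∂P =
      ∫ l, Complex.exp (∑ y, (l y : ℂ) * (Complex.I * v y)) *
        entireDensity ((A.submatrix e e).map Complex.ofReal) a b l ∂simplexMeasure a T := by
  have hT' : (0 : ℝ) < T := by exact_mod_cast hT
  have h1 := (hX.integrable_and_hasSum_covering he hT v b Finset.univ).2
  have h2 := (integrable_and_hasSum_integral_entireDensity ((A.submatrix e e).map Complex.ofReal +
        Matrix.diagonal fun y => Complex.I * v y) a b a hT').2
  -- The total mass for the tilted matrix `A + i diag v` is the characteristic function of the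
  -- density for `A`; both sides are now sums of the same series.
  simp only [entireDensity_add_diagonal] at h2
  have h3 := h1.unique h2
  simpa using h3

end Covering

/-! ### Densities determined by characteristic functions -/

section Uniqueness

variable {ι : Type*} [Fintype ι]

theorem isFiniteMeasure_withDensity_ofReal' {α : Type*} [MeasurableSpace α] {σ : Measure α}
    {f : α → ℝ} (hf : Integrable f σ) :
    IsFiniteMeasure (σ.withDensity fun l => ENNReal.ofReal (f l)) :=
  isFiniteMeasure_withDensity_ofReal hf.2

/-- Integrals against the density `max (f, 0)`. -/
theorem integral_withDensity_ofReal {α : Type*} [MeasurableSpace α] {σ : Measure α}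
    {f : α → ℝ} (hf : Integrable f σ) (g : α → ℂ) :
    ∫ l, g l ∂(σ.withDensity fun l => ENNReal.ofReal (f l)) = ∫ l, g l * (max (f l) 0 : ℝ) ∂σ := by
  rw [integral_withDensity_eq_integral_toReal_smul₀ hf.1.aemeasurable.ennreal_ofReal
    (ae_of_all _ fun _ => ENNReal.ofReal_lt_top)]
  refine integral_congr_ae (ae_of_all _ fun l => ?_)
  simp only [ENNReal.toReal_ofReal', Complex.real_smul]
  ring

theorem continuous_exp_sum_mul_I (v : ι → ℝ) :
    Continuous fun l : ι → ℝ => Complex.exp (∑ y, (l y : ℂ) * (Complex.I * v y)) := by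
  fun_prop

/-- A real density is determined by its characteristic function. -/
theorem integral_eq_of_charFun_eq_real {μ σ : Measure (ι → ℝ)} [IsFiniteMeasure μ]
    {f : (ι → ℝ) → ℝ} (hf : Integrable f σ)
    (h : ∀ v : ι → ℝ, ∫ l, Complex.exp (∑ y, (l y : ℂ) * (Complex.I * v y)) ∂μ =
      ∫ l, Complex.exp (∑ y, (l y : ℂ) * (Complex.I * v y)) * (f l : ℂ) ∂σ)
    {F : (ι → ℝ) → ℂ} (hF : Measurable F) {C : ℝ} (hC : ∀ l, ‖F l‖ ≤ C) :
    ∫ l, F l ∂μ = ∫ l, F l * (f l : ℂ) ∂σ := by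
  have := isFiniteMeasure_withDensity_ofReal' hf
  have := isFiniteMeasure_withDensity_ofReal' hf.neg
  set σp := σ.withDensity fun l => ENNReal.ofReal (f l)
  set σn := σ.withDensity fun l => ENNReal.ofReal ((-f) l)
  have hint : ∀ {G : (ι → ℝ) → ℂ} {C : ℝ}, Measurable G → (∀ l, ‖G l‖ ≤ C) →
      ∀ (τ : Measure (ι → ℝ)) [IsFiniteMeasure τ], Integrable G τ := fun hG hC τ _ =>
    Integrable.of_bound hG.aestronglyMeasurable _ (ae_of_all _ hC)
  have hdiff : ∀ {G : (ι → ℝ) → ℂ} {C : ℝ}, Measurable G → (∀ l, ‖G l‖ ≤ C) →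
      ∫ l, G l ∂σp - ∫ l, G l ∂σn = ∫ l, G l * (f l : ℂ) ∂σ := by
    intro G C hG hC
    rw [integral_withDensity_ofReal hf, integral_withDensity_ofReal hf.neg, ← integral_sub]
    · refine integral_congr_ae (ae_of_all _ fun l => ?_)
      beta_reduce
      rw [← mul_sub, ← Complex.ofReal_sub]
      congr 2
      simp only [Pi.neg_apply]
      rcases le_total 0 (f l) with h0 | h0
      · rw [max_eq_left h0, max_eq_right (by linarith), sub_zero]
      · rw [max_eq_right h0, max_eq_left (by linarith), sub_neg_eq_add, zero_add]
    · exact hf.pos_part.ofReal.bdd_mul hG.aestronglyMeasurable (ae_of_all _ hC)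
    · exact hf.neg.pos_part.ofReal.bdd_mul hG.aestronglyMeasurable (ae_of_all _ hC)
  -- Moving the negative part to the other side gives an identity between finite positive measures,
  -- to which uniqueness of characteristic functions applies.
  have hm : μ + σn = σp := by
    classical
    refine Measure.ext_of_charFunDual (funext fun L => ?_)
    have hL : ∀ l : ι → ℝ, Complex.exp (L l * Complex.I) =
        Complex.exp (∑ y, (l y : ℂ) * (Complex.I * (L (Pi.single y 1) : ℝ))) := by
      intro l
      congr 1
      rw [show L l = ∑ y, l y * L (Pi.single y 1) by
        conv_lhs => rw [pi_eq_sum_univ' l, map_sum]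
        simp]
      push_cast
      rw [Finset.sum_mul]
      refine Finset.sum_congr rfl fun y _ => ?_
      ring
    have hmeas := (continuous_exp_sum_mul_I fun y : ι => L (Pi.single y 1)).measurable
    have hbd := fun l : ι → ℝ => (norm_exp_sum_mul_I l fun y : ι => L (Pi.single y 1)).le
    simp only [charFunDual_apply, hL]
    rw [integral_add_measure (hint hmeas hbd _) (hint hmeas hbd _), h, ← hdiff hmeas hbd,
      sub_add_cancel]
  rw [← hdiff hF hC, ← hm, integral_add_measure (hint hF hC _) (hint hF hC _), add_sub_cancel_right]

/-- A complex density whose characteristic function is that of a measure is the density of that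
measure. -/
theorem integral_eq_of_charFun_eq {μ σ : Measure (ι → ℝ)} [IsFiniteMeasure μ]
    {ρ : (ι → ℝ) → ℂ} (hρ : Integrable ρ σ)
    (h : ∀ v : ι → ℝ, ∫ l, Complex.exp (∑ y, (l y : ℂ) * (Complex.I * v y)) ∂μ =
      ∫ l, Complex.exp (∑ y, (l y : ℂ) * (Complex.I * v y)) * ρ l ∂σ)
    {F : (ι → ℝ) → ℂ} (hF : Measurable F) {C : ℝ} (hC : ∀ l, ‖F l‖ ≤ C) :
    ∫ l, F l ∂μ = ∫ l, F l * ρ l ∂σ := by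
  have hint : ∀ {G : (ι → ℝ) → ℂ} {C : ℝ} {r : (ι → ℝ) → ℂ}, Measurable G → (∀ l, ‖G l‖ ≤ C) →
      Integrable r σ → Integrable (fun l => G l * r l) σ := fun hG hC hr =>
    hr.bdd_mul hG.aestronglyMeasurable (ae_of_all _ hC)
  have hre : Integrable (fun l => ((ρ l).re : ℂ)) σ := hρ.re.ofReal
  have him : Integrable (fun l => ((ρ l).im : ℂ)) σ := hρ.im.ofReal
  have hsplit : ∀ {G : (ι → ℝ) → ℂ} {C : ℝ}, Measurable G → (∀ l, ‖G l‖ ≤ C) →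
      ∫ l, G l * ρ l ∂σ =
        ∫ l, G l * ((ρ l).re : ℂ) ∂σ + (∫ l, G l * ((ρ l).im : ℂ) ∂σ) * Complex.I := by
    intro G C hG hC
    rw [← integral_mul_const, ← integral_add (hint hG hC hre) ((hint hG hC him).mul_const _)]
    refine integral_congr_ae (ae_of_all _ fun l => ?_)
    beta_reduce
    conv_lhs => rw [← Complex.re_add_im (ρ l)]
    ring
  let E : (ι → ℝ) → (ι → ℝ) → ℂ := fun v l => Complex.exp (∑ y, (l y : ℂ) * (Complex.I * v y))
  have hE : ∀ v, Measurable (E v) := fun v => (continuous_exp_sum_mul_I v).measurable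
  have hEb : ∀ v l, ‖E v l‖ ≤ 1 := fun v l => (norm_exp_sum_mul_I l v).le
  -- The density is not known to be real at this point. Conjugating the hypothesis at `-v` gives the
  -- same identity with the sign of the imaginary part reversed; half the sum and half the
  -- difference separate the parts, and the imaginary part has zero characteristic function.
  have hconj : ∀ v l, E v l = (starRingEnd ℂ) (E (-v) l) := by
    intro v l
    simp only [E, ← Complex.exp_conj, map_sum, map_mul, Complex.conj_ofReal, Complex.conj_I,
      Pi.neg_apply, Complex.ofReal_neg, map_neg]
    congr 1
    refine Finset.sum_congr rfl fun y _ => ?_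
    ring
  have hminus : ∀ v, ∫ l, E v l ∂μ =
      ∫ l, E v l * ((ρ l).re : ℂ) ∂σ - (∫ l, E v l * ((ρ l).im : ℂ) ∂σ) * Complex.I := by
    intro v
    have hc : ∀ r : (ι → ℝ) → ℝ, ∫ l, E v l * (r l : ℂ) ∂σ =
        (starRingEnd ℂ) (∫ l, E (-v) l * (r l : ℂ) ∂σ) := by
      intro r
      rw [← integral_conj]
      refine integral_congr_ae (ae_of_all _ fun l => ?_)
      simp [hconj v l]
    have hcμ : ∫ l, E v l ∂μ = (starRingEnd ℂ) (∫ l, E (-v) l ∂μ) := by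
      rw [← integral_conj]
      exact integral_congr_ae (ae_of_all _ fun l => hconj v l)
    rw [hc, hc, hcμ, h (-v), hsplit (hE (-v)) (hEb (-v)), map_add, map_mul, Complex.conj_I]
    ring
  have hplus : ∀ v, ∫ l, E v l ∂μ =
      ∫ l, E v l * ((ρ l).re : ℂ) ∂σ + (∫ l, E v l * ((ρ l).im : ℂ) ∂σ) * Complex.I := fun v =>
    (h v).trans (hsplit (hE v) (hEb v))
  have h1 := integral_eq_of_charFun_eq_real (μ := μ) (σ := σ) hρ.re (fun v => by
    change ∫ l, E v l ∂μ = ∫ l, E v l * ((ρ l).re : ℂ) ∂σ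
    linear_combination (hplus v + hminus v) / 2) hF hC
  have h2 := integral_eq_of_charFun_eq_real (μ := 0) (σ := σ) hρ.im (fun v => by
    rw [integral_zero_measure]
    change 0 = ∫ l, E v l * ((ρ l).im : ℂ) ∂σ
    have h3 : (∫ l, E v l * ((ρ l).im : ℂ) ∂σ) * Complex.I = 0 := by
      linear_combination (hminus v - hplus v) / 2
    exact ((mul_eq_zero.1 h3).resolve_right Complex.I_ne_zero).symm) hF hC
  rw [integral_zero_measure] at h2
  rw [hsplit hF hC, h1]
  simp only [RCLike.re_eq_complex_re, RCLike.im_eq_complex_im] at h2 ⊢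
  rw [← h2]
  simp

end Uniqueness

/-! ### The law of the local times -/

section Law

variable {Λ : Type*} [DecidableEq Λ] {Ω : Type*} [MeasurableSpace Ω] {ι : Type*} [Fintype ι]
  [DecidableEq ι]

/-- Joint measurability in time and `ω` is not assumed; the local time is instead an almost sure
limit of Riemann sums, each of which is measurable. -/
theorem IsMarkovChain.aemeasurable_localTime {P : Measure Ω} {A : Matrix Λ Λ ℝ} {a : Λ}
    {X : ℝ≥0 → Ω → Λ} (hX : IsMarkovChain P A a X) {T : ℝ≥0} (hT : 0 < T) (z : Λ) :
    AEMeasurable (localTime X T z) P := by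
  refine aemeasurable_of_tendsto_metrizable_ae atTop (f := fun (n : ℕ) ω =>
    ∑ i ∈ Finset.range n, (T / n : ℝ) * (if X ((i + 1 : ℕ) * (T / n)) ω = z then 1 else 0))
    (fun n => Measurable.aemeasurable ?_) ?_
  · refine Finset.measurable_fun_sum _ fun i _ => Measurable.const_mul ?_ _
    exact Measurable.ite (hX.measurable _ z) measurable_const measurable_const
  · filter_upwards [hX.right_continuous] with ω hω
    exact tendsto_riemann_sum hT (ξ := fun s => X s ω) hω z

/-- Integrals of bounded functions of the local times, on the event that the chain ends in `e b`
and visits precisely the states in the image of `e`. -/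
theorem IsMarkovChain.integral_localTime_eq {P : Measure Ω} [IsProbabilityMeasure P]
    {A : Matrix Λ Λ ℝ} {e : ι → Λ} (he : Function.Injective e) {a : ι} {X : ℝ≥0 → Ω → Λ}
    (hX : IsMarkovChain P A (e a) X) {T : ℝ≥0} (hT : 0 < T) (b : ι)
    {F : (ι → ℝ) → ℂ} (hF : Measurable F) {C : ℝ} (hC : ∀ l, ‖F l‖ ≤ C) :
    ∫ ω, Set.indicator {ω | X T ω = e b ∧ chainRange X T ω = Set.range e}
        (fun ω => F fun y => localTime X T (e y) ω) ω ∂P =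
      ∫ l, F l * entireDensity ((A.submatrix e e).map Complex.ofReal) a b l
        ∂simplexMeasure a T := by
  have hT' : (0 : ℝ) < T := by exact_mod_cast hT
  set E := {ω | X T ω = e b ∧ chainRange X T ω = Set.range e} with hE
  -- The range event involves uncountably many times. At `v = 0` the range functional is the
  -- indicator of `E`, and its almost everywhere strong measurability comes from the grid limit and
  -- the subtraction over subsets.
  have hEm : NullMeasurableSet E P := by
    have h1 := (hX.integrable_and_hasSum_covering he hT 0 b Finset.univ).1.aestronglyMeasurable
    have h2 : rangeFunctional X T e 0 (e b) (· = e '' (Finset.univ : Finset ι)) =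
        E.indicator fun _ => 1 := by
      simp [rangeFunctional, hE]
    rw [h2] at h1
    have h3 := h1.aemeasurable.nullMeasurableSet_preimage (measurableSet_singleton (1 : ℂ))
    convert h3 using 1
    ext ω
    by_cases hω : ω ∈ E <;> simp [hω]
  have hℓ : AEMeasurable (fun ω (y : ι) => localTime X T (e y) ω) P :=
    aemeasurable_pi_lambda _ fun y => hX.aemeasurable_localTime hT (e y)
  have hmap : ∀ {G : (ι → ℝ) → ℂ}, Measurable G →
      ∫ ω, E.indicator (fun ω => G fun y => localTime X T (e y) ω) ω ∂P =
        ∫ l, G l ∂((P.restrict E).map fun ω (y : ι) => localTime X T (e y) ω) := by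
    intro G hG
    rw [integral_map hℓ.restrict hG.aestronglyMeasurable, integral_indicator₀ hEm]
  rw [hmap hF]
  refine integral_eq_of_charFun_eq
    (integrable_and_hasSum_integral_entireDensity _ a b a hT').1 (fun v => ?_) hF hC
  rw [← hX.integral_rangeFunctional_eq he hT v b,
    ← hmap (continuous_exp_sum_mul_I v).measurable]
  rfl

end Law

end LocalTimes

end

theorem theorem2p1 {Λ : Type*} [Countable Λ] [DecidableEq Λ]
    {Ω : Type*} [MeasurableSpace Ω] (P : MeasureTheory.Measure Ω)
    [MeasureTheory.IsProbabilityMeasure P]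
    (A : Matrix Λ Λ ℝ) (hA : LocalTimes.IsConservativeGenerator A)
    (R : Finset Λ) (a b : R)
    (X : ℝ≥0 → Ω → Λ) (hX : LocalTimes.IsMarkovChain P A a X)
    (T : ℝ≥0) (hT : 0 < T) :
    MeasureTheory.Integrable
      (LocalTimes.density (A.submatrix (fun x : R => (x : Λ)) (fun x : R => (x : Λ))) a b)
      (LocalTimes.simplexMeasure a T) ∧
    ∀ F : (R → ℝ) → ℝ, Measurable F → (∃ C, ∀ l, |F l| ≤ C) →
      ((∫ ω, Set.indicator {ω | X T ω = b ∧ LocalTimes.chainRange X T ω = (R : Set Λ)}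
          (fun ω => F (fun x : R => LocalTimes.localTime X T x ω)) ω ∂P : ℝ) : ℂ) =
        ∫ l, (F l : ℂ) *
          LocalTimes.density (A.submatrix (fun x : R => (x : Λ)) (fun x : R => (x : Λ))) a b l
          ∂(LocalTimes.simplexMeasure a T) := by
  have hT' : (0 : ℝ) < T := by exact_mod_cast hT
  -- The two functions are identified only where all coordinates are positive, and the simplex
  -- measure is carried by such points.
  have hae : LocalTimes.density (A.submatrix (fun x : R => (x : Λ)) (fun x : R => (x : Λ))) a b
      =ᵐ[LocalTimes.simplexMeasure a T] LocalTimes.entireDensity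
        ((A.submatrix (fun x : R => (x : Λ)) (fun x : R => (x : Λ))).map Complex.ofReal) a b := by
    filter_upwards [LocalTimes.ae_simplexMeasure_mem a T] with l hl
    exact LocalTimes.density_eq_entireDensity _ a b hl.1
  refine ⟨(LocalTimes.integrable_and_hasSum_integral_entireDensity _ a b a hT').1.congr hae.symm,
    fun F hF ⟨C, hC⟩ => ?_⟩
  have h := hX.integral_localTime_eq (e := fun x : R => (x : Λ)) Subtype.val_injective hT b
    (F := fun l => (F l : ℂ)) (Complex.measurable_ofReal.comp hF) (C := C)
    (fun l => by simpa using hC l)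
  have hR : Set.range (fun x : R => (x : Λ)) = R := by simp
  rw [hR] at h
  calc _ = ∫ ω, Set.indicator {ω | X T ω = b ∧ LocalTimes.chainRange X T ω = (R : Set Λ)}
          (fun ω => ((F fun x : R => LocalTimes.localTime X T x ω : ℝ) : ℂ)) ω ∂P := by
        rw [← integral_complex_ofReal]
        refine integral_congr_ae (ae_of_all _ fun ω => ?_)
        simp only [Set.indicator]
        split_ifs <;> simp
    _ = _ := h
    _ = _ := by
        refine integral_congr_ae ?_
        filter_upwards [hae] with l hl
        rw [hl]
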